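/- Let $U,V,Z$ be finite sets, $U,V$ non-empty, and $f:U\times V\to Z$. A two-party quantum protocol $\pi$ for $f$ has Alice with input register $U$ and Bob with input register $V$; they alternately apply completely positive trace-preserving (CPTP) maps to their finite-dimensional memories and to message registers that they exchange in a fixed number of rounds, and each finally outputs a register $Z$. For strategies $A,B$ of the two parties with the same message registers (honest or not, with arbitrary finite-dimensional memories and outputs) let $\pi_{A,B}$ be the resulting CPTP map. Let $\mathcal F(|u\rangle\langle u'|\otimes|v\rangle\langle v'|)=\delta_{u,u'}\delta_{v,v'}\,|f(u,v)\rangle\langle f(u,v)|\otimes|f(u,v)\rangle\langle f(u,v)|$ be the ideal functionality. For a probability distribution $p$ on $U\times V$ let $\rho_{RUV}$ be the purification $\sum_{u,v}\sqrt{p(u,v)}\,|uv\rangle_R|uv\rangle_{UV}$ of the input distribution. Closeness of states is measured by the purified distance $C(\rho,\sigma)=\sqrt{1-F(\rho,\sigma)^2}$, where $F(\rho,\sigma)=\mathrm{tr}\sqrt{\sqrt\rho\,\sigma\sqrt\rho}$. With $\mathsf A,\mathsf B$ the honest strategies, $\pi$ is $\varepsilon$-correct if for every $p$ the states $[\mathrm{id}_R\otimes\pi_{\mathsf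 A,\mathsf B}](\rho_{RUV})$ and $[\mathrm{id}_R\otimes\mathcal F](\rho_{RUV})$ are at distance at most $\varepsilon$. It is $\varepsilon$-secure against Bob if for every $p$ and every strategy $\mathsf B'$ of Bob there are a finite-dimensional register $K$ and CPTP maps $\Lambda^1:V\to VK$ and $\Lambda^2:KZ\to Y'$ such that $[\mathrm{id}_R\otimes\pi_{\mathsf A,\mathsf B'}](\rho_{RUV})$ is at distance at most $\varepsilon$ from the state obtained by applying to $\rho_{RUV}$ first $\Lambda^1$, then $\mathcal F$, then $\Lambda^2$ (with Alice's registers and $R$ untouched by $\Lambda^1,\Lambda^2$). **Theorem.** Let $\pi$ be a protocol for $f$ that is perfectly correct and perfectly secure against Bob (both with $\varepsilon=0$). Then there is a strategy of Alice with an output register $V$ such that, for every input $u_0\in U$ of Alice and every input $v\in V$ of honest Bob, measuring her output register in the computational basis yields with probability one a $\tilde v$ with $f(u,v)=f(u,\tilde v)$ for all $u\in U$. Hence Alice can compute $f(u,v)$ for all $u\in U$. -/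

import Mathlib

/-! Finite-dimensional quantum systems are indexed by finite types: the register `a` has the
computational basis `(|i⟩)` with `i : a`, its operators are `Matrix a a ℂ`, and the joint register of
`a` and `b` is indexed by `a × b`. -/

namespace QTwoParty

noncomputable section

/-! ### Operators and channels -/

/-- `id_r ⊗ Φ`: the linear map `Φ` applied to the second register, the first one untouched. -/
def idTensor (r : Type) {a b : Type} (Φ : Matrix a a ℂ →ₗ[ℂ] Matrix b b ℂ) :
    Matrix (r × a) (r × a) ℂ →ₗ[ℂ] Matrix (r × b) (r × b) ℂ where
  toFun M := Matrix.of fun i j => Φ (Matrix.of fun x y => M (i.1, x) (j.1, y)) i.2 j.2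
  map_add' M N := by
    ext i j
    exact congrFun (congrFun (Φ.map_add (Matrix.of fun x y => M (i.1, x) (j.1, y))
      (Matrix.of fun x y => N (i.1, x) (j.1, y))) i.2) j.2
  map_smul' c M := by
    ext i j
    exact congrFun (congrFun (Φ.map_smul c (Matrix.of fun x y => M (i.1, x) (j.1, y))) i.2) j.2

/-- `Φ ⊗ id_r`: the linear map `Φ` applied to the first register, the second one untouched. -/
def tensorId (r : Type) {a b : Type} (Φ : Matrix a a ℂ →ₗ[ℂ] Matrix b b ℂ) :
    Matrix (a × r) (a × r) ℂ →ₗ[ℂ] Matrix (b × r) (b × r) ℂ where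
  toFun M := Matrix.of fun i j => Φ (Matrix.of fun x y => M (x, i.2) (y, j.2)) i.1 j.1
  map_add' M N := by
    ext i j
    exact congrFun (congrFun (Φ.map_add (Matrix.of fun x y => M (x, i.2) (y, j.2))
      (Matrix.of fun x y => N (x, i.2) (y, j.2))) i.1) j.1
  map_smul' c M := by
    ext i j
    exact congrFun (congrFun (Φ.map_smul c (Matrix.of fun x y => M (x, i.2) (y, j.2))) i.1) j.1

/-- Regrouping of three registers, `(a b) c` to `a (b c)`. -/
def regroupRight (a b c : Type) :
    Matrix ((a × b) × c) ((a × b) × c) ℂ →ₗ[ℂ] Matrix (a × b × c) (a × b × c) ℂ :=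
  (Matrix.reindexLinearEquiv ℂ ℂ (Equiv.prodAssoc a b c) (Equiv.prodAssoc a b c)).toLinearMap

/-- Regrouping of three registers, `a (b c)` to `(a b) c`. -/
def regroupLeft (a b c : Type) :
    Matrix (a × b × c) (a × b × c) ℂ →ₗ[ℂ] Matrix ((a × b) × c) ((a × b) × c) ℂ :=
  (Matrix.reindexLinearEquiv ℂ ℂ (Equiv.prodAssoc a b c).symm
    (Equiv.prodAssoc a b c).symm).toLinearMap

open scoped ComplexOrder in
/-- Completely positive trace-preserving maps from register `a` to register `b`. -/
structure Channel (a b : Type) [Fintype a] [Fintype b] where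
  map : Matrix a a ℂ →ₗ[ℂ] Matrix b b ℂ
  completely_positive : ∀ (k : ℕ) (M : Matrix (Fin k × a) (Fin k × a) ℂ),
    M.PosSemidef → (idTensor (Fin k) map M).PosSemidef
  trace_preserving : ∀ M : Matrix a a ℂ, (map M).trace = M.trace

/-! ### Distance of states -/

open scoped ComplexOrder MatrixOrder in
/-- The fidelity `F(ρ, σ) = tr √(√ρ σ √ρ)`. -/
def fidelity {a : Type} [Fintype a] [DecidableEq a] (ρ σ : Matrix a a ℂ) : ℝ :=
  (CFC.sqrt (CFC.sqrt ρ * σ * CFC.sqrt ρ)).trace.re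

/-- The purified distance `C(ρ, σ) = √(1 - F(ρ, σ)²)`. -/
def purifiedDistance {a : Type} [Fintype a] [DecidableEq a] (ρ σ : Matrix a a ℂ) : ℝ :=
  √(1 - fidelity ρ σ ^ 2)

/-! ### Two-party protocols -/

/-- The communication pattern of a protocol: the number of rounds and the quantum registers that
travel between the parties. `toBob i` is the `i`-th message from Alice to Bob (`i ≤ rounds`) and
`toAlice i` the `i`-th message from Bob to Alice (`i < rounds`); a trivial message is a
one-dimensional register. Entries with a larger index are not used. -/
structure Interface where
  rounds : ℕ
  toBob : ℕ → Type
  toAlice : ℕ → Type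
  [fintypeToBob : ∀ i, Fintype (toBob i)]
  [decEqToBob : ∀ i, DecidableEq (toBob i)]
  [fintypeToAlice : ∀ i, Fintype (toAlice i)]
  [decEqToAlice : ∀ i, DecidableEq (toAlice i)]

attribute [instance] Interface.fintypeToBob Interface.decEqToBob
  Interface.fintypeToAlice Interface.decEqToAlice

/-- A strategy of Alice (honest or dishonest), with input register `U` and output register `X`:
she turns her input into her first memory and the first message; on each message from Bob she
updates her memory and sends the next message; at the end she turns her memory into her output. -/
structure AliceStrategy (I : Interface) (U X : Type) [Fintype U] [Fintype X] where
  mem : ℕ → Type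
  [fintypeMem : ∀ i, Fintype (mem i)]
  [decEqMem : ∀ i, DecidableEq (mem i)]
  init : Channel U (mem 0 × I.toBob 0)
  step : ∀ i, Channel (mem i × I.toAlice i) (mem (i + 1) × I.toBob (i + 1))
  final : Channel (mem I.rounds) X

attribute [instance] AliceStrategy.fintypeMem AliceStrategy.decEqMem

/-- A strategy of Bob (honest or dishonest), with input register `V` and output register `Y`:
he turns his input into his first memory; on each message from Alice he updates his memory and
sends a message back; he turns the last message and his memory into his output. -/
structure BobStrategy (I : Interface) (V Y : Type) [Fintype V] [Fintype Y] where
  mem : ℕ → Type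
  [fintypeMem : ∀ i, Fintype (mem i)]
  [decEqMem : ∀ i, DecidableEq (mem i)]
  init : Channel V (mem 0)
  step : ∀ i, Channel (I.toBob i × mem i) (I.toAlice i × mem (i + 1))
  final : Channel (I.toBob I.rounds × mem I.rounds) Y

attribute [instance] BobStrategy.fintypeMem BobStrategy.decEqMem

/-- The map from the two inputs to the joint state (Alice's memory, message to Bob, Bob's memory)
when `i` rounds are over and Alice has sent her message number `i`. -/
def runTo {I : Interface} {U V X Y : Type} [Fintype U] [Fintype V] [Fintype X] [Fintype Y]
    (A : AliceStrategy I U X) (B : BobStrategy I V Y) :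
    (i : ℕ) → (Matrix (U × V) (U × V) ℂ →ₗ[ℂ]
      Matrix ((A.mem i × I.toBob i) × B.mem i) ((A.mem i × I.toBob i) × B.mem i) ℂ)
  | 0 => tensorId (B.mem 0) A.init.map ∘ₗ idTensor U B.init.map
  | i + 1 =>
      tensorId (B.mem (i + 1)) (A.step i).map ∘ₗ
        regroupLeft (A.mem i) (I.toAlice i) (B.mem (i + 1)) ∘ₗ
          idTensor (A.mem i) (B.step i).map ∘ₗ
            regroupRight (A.mem i) (I.toBob i) (B.mem i) ∘ₗ runTo A B i

/-- The map `U V → X Y` of a complete execution with the strategies `A` and `B`. -/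
def run {I : Interface} {U V X Y : Type} [Fintype U] [Fintype V] [Fintype X] [Fintype Y]
    (A : AliceStrategy I U X) (B : BobStrategy I V Y) :
    Matrix (U × V) (U × V) ℂ →ₗ[ℂ] Matrix (X × Y) (X × Y) ℂ :=
  tensorId Y A.final.map ∘ₗ idTensor (A.mem I.rounds) B.final.map ∘ₗ
    regroupRight (A.mem I.rounds) (I.toBob I.rounds) (B.mem I.rounds) ∘ₗ runTo A B I.rounds

/-- A two-party quantum protocol for the evaluation of a function `U → V → Z`: a communication
pattern and the honest strategies of both parties, each of which outputs a register `Z`. -/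
structure Protocol (U V Z : Type) [Fintype U] [Fintype V] [Fintype Z] where
  interface : Interface
  alice : AliceStrategy interface U Z
  bob : BobStrategy interface V Z

/-! ### The ideal world -/

/-- The ideal functionality: measure both inputs in the computational basis and give the function
value to both parties, `|u⟩⟨u'| ⊗ |v⟩⟨v'| ↦ δ_{u,u'} δ_{v,v'} |f(u,v)⟩⟨f(u,v)| ⊗ |f(u,v)⟩⟨f(u,v)|`. -/
def idealFunctionality {U V Z : Type} [Fintype U] [Fintype V] [DecidableEq Z] (f : U → V → Z) :
    Matrix (U × V) (U × V) ℂ →ₗ[ℂ] Matrix (Z × Z) (Z × Z) ℂ :=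
  ∑ w : U × V, (Matrix.singleLinearMap ℂ (f w.1 w.2, f w.1 w.2) (f w.1 w.2, f w.1 w.2)) ∘ₗ
    Matrix.entryLinearMap ℂ ℂ w w

/-- An ideal adversary in Bob's place: a channel applied to his input, which yields the input to the
functionality and a register `K` that he keeps, and a channel applied to the output of the
functionality and `K`. -/
structure IdealBob (V Z Y : Type) [Fintype V] [Fintype Z] [Fintype Y] where
  K : Type
  [fintypeK : Fintype K]
  [decEqK : DecidableEq K]
  pre : Channel V (V × K)
  post : Channel (Z × K) Y

attribute [instance] IdealBob.fintypeK IdealBob.decEqK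

/-- The map `U V → X Y` of the ideal world with honest Alice and the ideal adversary `B`. -/
def idealRun {U V Z Y : Type} [Fintype U] [Fintype V] [Fintype Z] [DecidableEq Z] [Fintype Y]
    (f : U → V → Z) (B : IdealBob V Z Y) :
    Matrix (U × V) (U × V) ℂ →ₗ[ℂ] Matrix (Z × Y) (Z × Y) ℂ :=
  idTensor Z B.post.map ∘ₗ regroupRight Z Z B.K ∘ₗ
    tensorId B.K (idealFunctionality f) ∘ₗ regroupLeft U V B.K ∘ₗ idTensor U B.pre.map

/-! ### Correctness and security -/

/-- The canonical purification `∑_w √p(w) |w⟩_R |w⟩` of the classical state `∑_w p(w) |w⟩⟨w|`, as a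
density matrix; the reference `R` is the first register. Every other purification arises from it by
a (partial) isometry on `R`. -/
def purifiedInput {W : Type} [DecidableEq W] (p : W → ℝ) : Matrix (W × W) (W × W) ℂ :=
  Matrix.vecMulVec (fun w => if w.1 = w.2 then ((√(p w.1) : ℝ) : ℂ) else 0)
    (star fun w => if w.1 = w.2 then ((√(p w.1) : ℝ) : ℂ) else 0)

/-- `π` is an `ε`-correct protocol for `f`. -/
def IsCorrect {U V Z : Type} [Fintype U] [DecidableEq U] [Fintype V] [DecidableEq V]
    [Fintype Z] [DecidableEq Z] (π : Protocol U V Z) (f : U → V → Z) (ε : ℝ) : Prop :=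
  ∀ p ∈ stdSimplex ℝ (U × V),
    purifiedDistance (idTensor (U × V) (run π.alice π.bob) (purifiedInput p))
      (idTensor (U × V) (idealFunctionality f) (purifiedInput p)) ≤ ε

/-- `π` is an `ε`-secure protocol for `f` against dishonest Bob: for every input distribution and
every real adversary there is an ideal adversary with an `ε`-close output state. -/
def IsSecureAgainstBob {U V Z : Type} [Fintype U] [DecidableEq U] [Fintype V] [DecidableEq V]
    [Fintype Z] [DecidableEq Z] (π : Protocol U V Z) (f : U → V → Z) (ε : ℝ) : Prop :=
  ∀ p ∈ stdSimplex ℝ (U × V), ∀ (Y : Type) [Fintype Y] [DecidableEq Y]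
    (B' : BobStrategy π.interface V Y), ∃ B : IdealBob V Z Y,
      purifiedDistance (idTensor (U × V) (run π.alice B') (purifiedInput p))
        (idTensor (U × V) (idealRun f B) (purifiedInput p)) ≤ ε

/-- The probability that Alice, with the strategy `A` and input `u`, finds `x` when she measures her
output register in the computational basis, while Bob plays `B` with input `v`. -/
def aliceOutcomeProb {I : Interface} {U V X Y : Type} [Fintype U] [DecidableEq U] [Fintype V]
    [DecidableEq V] [Fintype X] [Fintype Y] (A : AliceStrategy I U X) (B : BobStrategy I V Y)
    (u : U) (v : V) (x : X) : ℝ :=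
  ∑ y : Y, (run A B (Matrix.single (u, v) (u, v) 1) (x, y) (x, y)).re

end

end QTwoParty

namespace QTwoParty
open Matrix
open scoped ComplexOrder

/-! Let Bob play honestly, but with every channel replaced by a Stinespring dilation whose
environment he keeps. Alice cannot notice this, yet it is an attack to which security applies, so
the execution equals an ideal one. There the simulator sends some `w` to the functionality, with a
probability that depends on `v` but not on `u`. By correctness Alice's output `f u w` must be `f u
v` for every `u`, so `w` is always equivalent to `v` (`IdealBob.inputProb_eq_zero`).

It remains to let Alice learn `w`. The ideal execution is a sum of completely positive branches, one
for each `w`, so the Choi matrix of the real execution is a sum of positive semidefinite matrices.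
If Alice dilates her channels too, the global map is `ρ ↦ W ρ Wᴴ` and her environment purifies that
Choi matrix. By the steering argument `exists_povm_of_sum_eq`, a measurement of this environment
realizes the decomposition. It acts at the level of Choi matrices, so a single measurement serves
all inputs (`exists_alice_measuring_branch`).

Both uses of perfect closeness need only the uniform input distribution: its purification has full
Schmidt rank, so equal output states force equal maps (`map_eq_of_purifiedDistance_nonpos`). -/

open scoped MatrixOrder in
theorem exists_eq_conjTranspose_mul_self {a : Type} [Fintype a] {A : Matrix a a ℂ}
    (hA : A.PosSemidef) : ∃ S : Matrix a a ℂ, A = Sᴴ * S := by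
  classical
  exact CStarAlgebra.nonneg_iff_eq_star_mul_self.mp hA.nonneg

/-! ### Linear maps on registers: Kraus forms, Choi matrices, Stinespring dilations. -/

section LinearMaps

variable {a b c r s : Type}

@[simp] theorem idTensor_apply (Φ : Matrix a a ℂ →ₗ[ℂ] Matrix b b ℂ) (M : Matrix (r × a) (r × a) ℂ)
    (i j : r × b) :
    idTensor r Φ M i j = Φ (Matrix.of fun x y => M (i.1, x) (j.1, y)) i.2 j.2 := rfl

@[simp] theorem tensorId_apply (Φ : Matrix a a ℂ →ₗ[ℂ] Matrix b b ℂ) (M : Matrix (a × r) (a × r) ℂ)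
    (i j : b × r) :
    tensorId r Φ M i j = Φ (Matrix.of fun x y => M (x, i.2) (y, j.2)) i.1 j.1 := rfl

@[simp] theorem regroupRight_apply (M : Matrix ((a × b) × c) ((a × b) × c) ℂ) (i j : a × b × c) :
    regroupRight a b c M i j = M ((i.1, i.2.1), i.2.2) ((j.1, j.2.1), j.2.2) := rfl

@[simp] theorem regroupLeft_apply (M : Matrix (a × b × c) (a × b × c) ℂ) (i j : (a × b) × c) :
    regroupLeft a b c M i j = M (i.1.1, i.1.2, i.2) (j.1.1, j.1.2, j.2) := rfl

/-- A linear map in terms of its values on matrix units. -/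
theorem map_eq_sum_single [Fintype a] [DecidableEq a] (Φ : Matrix a a ℂ →ₗ[ℂ] Matrix b b ℂ)
    (M : Matrix a a ℂ) (i j : b) :
    Φ M i j = ∑ x, ∑ y, M x y * Φ (Matrix.single x y 1) i j := by
  conv_lhs => rw [Matrix.matrix_eq_sum_single M]
  simp only [map_sum, Matrix.sum_apply]
  refine Finset.sum_congr rfl fun x _ => Finset.sum_congr rfl fun y _ => ?_
  rw [← smul_eq_mul, ← Matrix.smul_apply, ← map_smul, Matrix.smul_single, smul_eq_mul, mul_one]

/-- Maps that act on different registers commute. -/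
theorem tensorId_comp_idTensor {a' b' : Type} [Fintype a] [Fintype b]
    (Φ : Matrix a a ℂ →ₗ[ℂ] Matrix a' a' ℂ) (Ψ : Matrix b b ℂ →ₗ[ℂ] Matrix b' b' ℂ) :
    tensorId b' Φ ∘ₗ idTensor a Ψ = idTensor a' Ψ ∘ₗ tensorId b Φ := by
  classical
  ext M ⟨i, k⟩ ⟨j, l⟩
  simp only [LinearMap.comp_apply, tensorId_apply, idTensor_apply]
  rw [map_eq_sum_single Φ, map_eq_sum_single Ψ]
  simp only [Matrix.of_apply]
  simp_rw [map_eq_sum_single Ψ (Matrix.of _), map_eq_sum_single Φ (Matrix.of _), Finset.sum_mul]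
  calc _ = ∑ x, ∑ z, ∑ y, ∑ w, M (x, z) (y, w) * Ψ (single z w 1) k l * Φ (single x y 1) i j :=
        Finset.sum_congr rfl fun x _ => Finset.sum_comm
    _ = ∑ z, ∑ x, ∑ w, ∑ y, M (x, z) (y, w) * Ψ (single z w 1) k l * Φ (single x y 1) i j := by
        rw [Finset.sum_comm]
        exact Finset.sum_congr rfl fun z _ => Finset.sum_congr rfl fun x _ => Finset.sum_comm
    _ = _ := by
        refine Finset.sum_congr rfl fun z _ => ?_
        rw [Finset.sum_comm]
        refine Finset.sum_congr rfl fun w _ => Finset.sum_congr rfl fun x _ =>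
          Finset.sum_congr rfl fun y _ => ?_
        simp only [Matrix.of_apply]
        ring

/-- The map `ρ ↦ W ρ Wᴴ`. -/
noncomputable def conjMap [Fintype a] (W : Matrix b a ℂ) : Matrix a a ℂ →ₗ[ℂ] Matrix b b ℂ where
  toFun M := W * M * Wᴴ
  map_add' M N := by rw [Matrix.mul_add, Matrix.add_mul]
  map_smul' c M := by simp

theorem conjMap_apply [Fintype a] (W : Matrix b a ℂ) (M : Matrix a a ℂ) :
    conjMap W M = W * M * Wᴴ := rfl

theorem conjMap_entry [Fintype a] (W : Matrix b a ℂ) (M : Matrix a a ℂ) (i j : b) :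
    conjMap W M i j = ∑ x, ∑ y, W i x * M x y * star (W j y) := by
  simp only [conjMap_apply, Matrix.mul_apply, Matrix.conjTranspose_apply, Finset.sum_mul]
  exact Finset.sum_comm

theorem conjMap_single [Fintype a] [DecidableEq a] (W : Matrix b a ℂ) (x y : a) (i j : b) :
    conjMap W (Matrix.single x y 1) i j = W i x * star (W j y) := by
  rw [conjMap_entry, Finset.sum_eq_single x, Finset.sum_eq_single y]
  · simp
  · intro z _ hz; simp [hz.symm]
  · simp
  · intro z _ hz; simp [hz.symm]
  · simp

theorem conjMap_comp [Fintype a] [Fintype b] (W : Matrix c b ℂ) (W' : Matrix b a ℂ) :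
    conjMap W ∘ₗ conjMap W' = conjMap (W * W') := by
  refine LinearMap.ext fun M => ?_
  simp only [LinearMap.comp_apply, conjMap_apply, Matrix.conjTranspose_mul, Matrix.mul_assoc]

theorem posSemidef_conjMap [Fintype a] [Fintype b] (W : Matrix b a ℂ) {M : Matrix a a ℂ}
    (hM : M.PosSemidef) : (conjMap W M).PosSemidef := hM.mul_mul_conjTranspose_same W

theorem idTensor_conjMap [Fintype a] [Fintype r] [DecidableEq r] (W : Matrix b a ℂ) :
    idTensor r (conjMap W) =
      conjMap (Matrix.of fun (i : r × b) (x : r × a) => if i.1 = x.1 then W i.2 x.2 else 0) := by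
  ext M ⟨i, k⟩ ⟨j, l⟩
  simp only [idTensor_apply, conjMap_entry, Fintype.sum_prod_type, Matrix.of_apply]
  rw [Finset.sum_eq_single i]
  · refine Finset.sum_congr rfl fun x _ => ?_
    rw [Finset.sum_eq_single j]
    · simp
    · intro z _ hz; simp [hz.symm]
    · simp
  · intro z _ hz; simp [hz.symm]
  · simp

theorem tensorId_conjMap [Fintype a] [Fintype r] [DecidableEq r] (W : Matrix b a ℂ) :
    tensorId r (conjMap W) =
      conjMap (Matrix.of fun (i : b × r) (x : a × r) => if i.2 = x.2 then W i.1 x.1 else 0) := by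
  ext M ⟨i, k⟩ ⟨j, l⟩
  simp only [tensorId_apply, conjMap_entry, Fintype.sum_prod_type, Matrix.of_apply]
  refine Finset.sum_congr rfl fun x _ => ?_
  rw [Finset.sum_eq_single k]
  · refine Finset.sum_congr rfl fun y _ => ?_
    rw [Finset.sum_eq_single l]
    · simp
    · intro z _ hz; simp [hz.symm]
    · simp
  · intro z _ hz; simp [hz.symm]
  · simp

/-- Relabelling of the basis of a register. -/
noncomputable def relabel (e : a ≃ b) : Matrix a a ℂ →ₗ[ℂ] Matrix b b ℂ :=
  (Matrix.reindexLinearEquiv ℂ ℂ e e).toLinearMap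

@[simp] theorem relabel_apply (e : a ≃ b) (M : Matrix a a ℂ) (i j : b) :
    relabel e M i j = M (e.symm i) (e.symm j) := rfl

theorem relabel_eq_conjMap [Fintype a] [DecidableEq a] (e : a ≃ b) :
    relabel e = conjMap (Matrix.of fun (i : b) (x : a) => if e.symm i = x then (1 : ℂ) else 0) := by
  ext M i j
  simp [conjMap_entry]

/-! ### Predicates on linear maps -/

/-- Maps `ρ ↦ W ρ Wᴴ`. -/
def IsConj [Fintype a] (Φ : Matrix a a ℂ →ₗ[ℂ] Matrix b b ℂ) : Prop :=
  ∃ W, Φ = conjMap W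

theorem IsConj.comp [Fintype a] [Fintype b] {Φ : Matrix b b ℂ →ₗ[ℂ] Matrix c c ℂ}
    {Ψ : Matrix a a ℂ →ₗ[ℂ] Matrix b b ℂ} (hΦ : IsConj Φ) (hΨ : IsConj Ψ) : IsConj (Φ ∘ₗ Ψ) := by
  obtain ⟨W, rfl⟩ := hΦ
  obtain ⟨W', rfl⟩ := hΨ
  exact ⟨_, conjMap_comp W W'⟩

theorem IsConj.idTensor [Fintype a] (r : Type) [Fintype r] {Φ : Matrix a a ℂ →ₗ[ℂ] Matrix b b ℂ}
    (hΦ : IsConj Φ) : IsConj (idTensor r Φ) := by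
  classical
  obtain ⟨W, rfl⟩ := hΦ
  exact ⟨_, idTensor_conjMap W⟩

theorem IsConj.tensorId [Fintype a] (r : Type) [Fintype r] {Φ : Matrix a a ℂ →ₗ[ℂ] Matrix b b ℂ}
    (hΦ : IsConj Φ) : IsConj (tensorId r Φ) := by
  classical
  obtain ⟨W, rfl⟩ := hΦ
  exact ⟨_, tensorId_conjMap W⟩

theorem isConj_relabel [Fintype a] (e : a ≃ b) : IsConj (relabel e) := by
  classical
  exact ⟨_, relabel_eq_conjMap e⟩

/-- Maps with a finite Kraus decomposition. -/
def HasKraus [Fintype a] (Φ : Matrix a a ℂ →ₗ[ℂ] Matrix b b ℂ) : Prop :=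
  ∃ (ι : Type) (_ : Fintype ι) (K : ι → Matrix b a ℂ), Φ = ∑ i, conjMap (K i)

theorem IsConj.hasKraus [Fintype a] {Φ : Matrix a a ℂ →ₗ[ℂ] Matrix b b ℂ} (hΦ : IsConj Φ) :
    HasKraus Φ := by
  obtain ⟨W, rfl⟩ := hΦ
  exact ⟨Unit, inferInstance, fun _ => W, by simp⟩

theorem HasKraus.comp [Fintype a] [Fintype b] {Φ : Matrix b b ℂ →ₗ[ℂ] Matrix c c ℂ}
    {Ψ : Matrix a a ℂ →ₗ[ℂ] Matrix b b ℂ} (hΦ : HasKraus Φ) (hΨ : HasKraus Ψ) :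
    HasKraus (Φ ∘ₗ Ψ) := by
  obtain ⟨ι, _, K, rfl⟩ := hΦ
  obtain ⟨κ, _, L, rfl⟩ := hΨ
  refine ⟨ι × κ, inferInstance, fun p => K p.1 * L p.2, ?_⟩
  refine LinearMap.ext fun M => ?_
  simp only [LinearMap.comp_apply, LinearMap.sum_apply, map_sum, Fintype.sum_prod_type,
    ← conjMap_comp]
  exact Finset.sum_comm

theorem idTensor_sum {ι : Type} (s : Finset ι) (Φ : ι → Matrix a a ℂ →ₗ[ℂ] Matrix b b ℂ) :
    idTensor r (∑ i ∈ s, Φ i) = ∑ i ∈ s, idTensor r (Φ i) := by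
  ext M i j
  simp [LinearMap.sum_apply, Matrix.sum_apply]

theorem tensorId_sum {ι : Type} (s : Finset ι) (Φ : ι → Matrix a a ℂ →ₗ[ℂ] Matrix b b ℂ) :
    tensorId r (∑ i ∈ s, Φ i) = ∑ i ∈ s, tensorId r (Φ i) := by
  ext M i j
  simp [LinearMap.sum_apply, Matrix.sum_apply]

theorem HasKraus.idTensor [Fintype a] (r : Type) [Fintype r] {Φ : Matrix a a ℂ →ₗ[ℂ] Matrix b b ℂ}
    (hΦ : HasKraus Φ) : HasKraus (idTensor r Φ) := by
  classical
  obtain ⟨ι, _, K, rfl⟩ := hΦ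
  rw [idTensor_sum, Finset.sum_congr rfl fun i _ => idTensor_conjMap (K i)]
  exact ⟨ι, inferInstance, _, rfl⟩

theorem HasKraus.tensorId [Fintype a] (r : Type) [Fintype r] {Φ : Matrix a a ℂ →ₗ[ℂ] Matrix b b ℂ}
    (hΦ : HasKraus Φ) : HasKraus (tensorId r Φ) := by
  classical
  obtain ⟨ι, _, K, rfl⟩ := hΦ
  rw [tensorId_sum, Finset.sum_congr rfl fun i _ => tensorId_conjMap (K i)]
  exact ⟨ι, inferInstance, _, rfl⟩

theorem HasKraus.sum [Fintype a] {ι : Type} [Fintype ι] {Φ : ι → Matrix a a ℂ →ₗ[ℂ] Matrix b b ℂ}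
    (hΦ : ∀ i, HasKraus (Φ i)) : HasKraus (∑ i, Φ i) := by
  choose κ hκ K hK using hΦ
  refine ⟨Σ i, κ i, inferInstance, fun p => K p.1 p.2, ?_⟩
  rw [Fintype.sum_sigma]
  exact Finset.sum_congr rfl fun i _ => hK i

theorem HasKraus.posSemidef [Fintype a] [Fintype b] {Φ : Matrix a a ℂ →ₗ[ℂ] Matrix b b ℂ}
    (hΦ : HasKraus Φ) {M : Matrix a a ℂ} (hM : M.PosSemidef) : (Φ M).PosSemidef := by
  obtain ⟨ι, _, K, rfl⟩ := hΦ
  rw [LinearMap.sum_apply]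
  exact Matrix.posSemidef_sum _ fun i _ => posSemidef_conjMap (K i) hM

/-- Trace preservation. -/
def IsTP [Fintype a] [Fintype b] (Φ : Matrix a a ℂ →ₗ[ℂ] Matrix b b ℂ) : Prop :=
  ∀ M, (Φ M).trace = M.trace

theorem IsTP.comp [Fintype a] [Fintype b] [Fintype c] {Φ : Matrix b b ℂ →ₗ[ℂ] Matrix c c ℂ}
    {Ψ : Matrix a a ℂ →ₗ[ℂ] Matrix b b ℂ} (hΦ : IsTP Φ) (hΨ : IsTP Ψ) : IsTP (Φ ∘ₗ Ψ) :=
  fun M => (hΦ _).trans (hΨ M)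

theorem IsTP.idTensor [Fintype a] [Fintype b] (r : Type) [Fintype r]
    {Φ : Matrix a a ℂ →ₗ[ℂ] Matrix b b ℂ} (hΦ : IsTP Φ) : IsTP (idTensor r Φ) := by
  intro M
  simp only [Matrix.trace, Fintype.sum_prod_type, Matrix.diag_apply, idTensor_apply]
  exact Finset.sum_congr rfl fun i _ => hΦ (Matrix.of fun x y => M (i, x) (i, y))

theorem IsTP.tensorId [Fintype a] [Fintype b] (r : Type) [Fintype r]
    {Φ : Matrix a a ℂ →ₗ[ℂ] Matrix b b ℂ} (hΦ : IsTP Φ) : IsTP (tensorId r Φ) := by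
  intro M
  simp only [Matrix.trace, Fintype.sum_prod_type_right, Matrix.diag_apply, tensorId_apply]
  exact Finset.sum_congr rfl fun i _ => hΦ (Matrix.of fun x y => M (x, i) (y, i))

theorem isTP_relabel [Fintype a] [Fintype b] (e : a ≃ b) : IsTP (relabel e) := by
  intro M
  simp only [Matrix.trace, Matrix.diag_apply, relabel_apply]
  exact Equiv.sum_comp e.symm fun i => M i i

/-- The channel given by a trace-preserving map with a Kraus decomposition. -/
def Channel.ofKraus [Fintype a] [Fintype b] (Φ : Matrix a a ℂ →ₗ[ℂ] Matrix b b ℂ)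
    (hK : HasKraus Φ) (hT : IsTP Φ) : Channel a b where
  map := Φ
  completely_positive k _ hM := (hK.idTensor (Fin k)).posSemidef hM
  trace_preserving := hT

theorem Channel.isTP [Fintype a] [Fintype b] (Φ : Channel a b) : IsTP Φ.map := Φ.trace_preserving

/-- The Choi matrix of a linear map. -/
def choi [DecidableEq a] (Φ : Matrix a a ℂ →ₗ[ℂ] Matrix b b ℂ) : Matrix (a × b) (a × b) ℂ :=
  Matrix.of fun i j => Φ (Matrix.single i.1 j.1 1) i.2 j.2

theorem HasKraus.posSemidef_choi [Fintype a] [DecidableEq a] [Fintype b]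
    {Φ : Matrix a a ℂ →ₗ[ℂ] Matrix b b ℂ} (hΦ : HasKraus Φ) : (choi Φ).PosSemidef := by
  have h : choi Φ = QTwoParty.idTensor a Φ (Matrix.vecMulVec
      (fun i : a × a => if i.1 = i.2 then (1 : ℂ) else 0)
      (star fun i : a × a => if i.1 = i.2 then (1 : ℂ) else 0)) := by
    ext i j
    simp only [choi, Matrix.of_apply, idTensor_apply]
    refine congrFun (congrFun (congrArg Φ ?_) _) _
    ext x y
    simp only [Matrix.single_apply, Matrix.vecMulVec_apply, ite_and, Matrix.of_apply, Pi.star_apply]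
    split_ifs <;> simp
  rw [h]
  exact (hΦ.idTensor a).posSemidef (Matrix.posSemidef_vecMulVec_self_star _)

/-- Complete positivity is postulated only for ancillas `Fin k`, so the maximally entangled vector
is written along an enumeration of `a` and the result is pulled back. -/
theorem Channel.posSemidef_choi [Fintype a] [DecidableEq a] [Fintype b] (Φ : Channel a b) :
    (choi Φ.map).PosSemidef := by
  let e := Fintype.equivFin a
  have h := Φ.completely_positive (Fintype.card a) _ (Matrix.posSemidef_vecMulVec_self_star
    (fun i : Fin (Fintype.card a) × a => if i.1 = e i.2 then (1 : ℂ) else 0))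
  have h' := h.submatrix fun i : a × b => (e i.1, i.2)
  convert h' using 1
  ext i j
  simp only [choi, Matrix.of_apply, Matrix.submatrix_apply, idTensor_apply]
  refine congrFun (congrFun (congrArg Φ.map ?_) _) _
  ext x y
  simp only [Matrix.single_apply, Matrix.vecMulVec_apply, ite_and, Matrix.of_apply, Pi.star_apply,
    EmbeddingLike.apply_eq_iff_eq]
  split_ifs <;> simp

/-- Factor the Choi matrix as `Sᴴ * S`; each row of `S`, conjugated and reshaped, is a Kraus
operator. -/
theorem Channel.exists_kraus [Fintype a] [Fintype b] (Φ : Channel a b) :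
    ∃ K : a × b → Matrix b a ℂ, Φ.map = ∑ m, conjMap (K m) := by
  classical
  obtain ⟨S, hS⟩ := exists_eq_conjTranspose_mul_self Φ.posSemidef_choi
  refine ⟨fun m => Matrix.of fun i x => star (S m (x, i)), ?_⟩
  refine LinearMap.ext fun M => ?_
  ext i j
  rw [map_eq_sum_single Φ.map, map_eq_sum_single (∑ m, _)]
  refine Finset.sum_congr rfl fun x _ => Finset.sum_congr rfl fun y _ => ?_
  have h := congrFun (congrFun hS (x, i)) (y, j)
  simp only [choi, Matrix.of_apply, Matrix.mul_apply, Matrix.conjTranspose_apply] at h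
  rw [h]
  simp only [LinearMap.sum_apply, Matrix.sum_apply, conjMap_single, Matrix.of_apply, star_star]

theorem Channel.hasKraus [Fintype a] [Fintype b] (Φ : Channel a b) : HasKraus Φ.map := by
  obtain ⟨K, hK⟩ := Φ.exists_kraus
  exact ⟨_, inferInstance, K, hK⟩

/-! ### Dilations -/

/-- The partial trace over the second register. -/
def traceRight (a b : Type) [Fintype b] : Matrix (a × b) (a × b) ℂ →ₗ[ℂ] Matrix a a ℂ where
  toFun M := Matrix.of fun i j => ∑ e, M (i, e) (j, e)
  map_add' M N := by ext; simp [Finset.sum_add_distrib]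
  map_smul' c M := by ext; simp [Finset.mul_sum]

@[simp] theorem traceRight_apply [Fintype b] (M : Matrix (a × b) (a × b) ℂ) (i j : a) :
    traceRight a b M i j = ∑ e, M (i, e) (j, e) := rfl

theorem isTP_traceRight [Fintype a] [Fintype b] : IsTP (traceRight a b) := by
  intro M
  simp [Matrix.trace, Fintype.sum_prod_type]

/-- Stack the Kraus operators into one matrix whose environment register is their index set; tracing
that register out sums over them. Trace preservation is inherited from `Φ`, since the partial trace
preserves the trace. -/
theorem Channel.exists_dilation [Fintype a] [Fintype b] (Φ : Channel a b) :
    ∃ Ψ : Channel a (b × (a × b)), IsConj Ψ.map ∧ traceRight b (a × b) ∘ₗ Ψ.map = Φ.map := by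
  obtain ⟨K, hK⟩ := Φ.exists_kraus
  let W : Matrix (b × (a × b)) a ℂ := Matrix.of fun i x => K i.2 i.1 x
  have h : traceRight b (a × b) ∘ₗ conjMap W = Φ.map := by
    refine LinearMap.ext fun M => ?_
    ext i j
    simp only [hK, LinearMap.comp_apply, traceRight_apply, LinearMap.sum_apply, Matrix.sum_apply,
      conjMap_entry, W, Matrix.of_apply]
  refine ⟨Channel.ofKraus (conjMap W) (IsConj.hasKraus ⟨W, rfl⟩) fun M => ?_, ⟨W, rfl⟩, h⟩
  rw [← isTP_traceRight, ← Φ.isTP M, ← h]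
  rfl

/-- A Stinespring dilation of a channel. -/
noncomputable def Channel.dilation [Fintype a] [Fintype b] (Φ : Channel a b) :
    Channel a (b × (a × b)) := Φ.exists_dilation.choose

theorem Channel.isConj_dilation [Fintype a] [Fintype b] (Φ : Channel a b) :
    IsConj Φ.dilation.map := Φ.exists_dilation.choose_spec.1

theorem Channel.sum_dilation [Fintype a] [Fintype b] (Φ : Channel a b) (M : Matrix a a ℂ)
    (i j : b) : ∑ m, Φ.dilation.map M (i, m) (j, m) = Φ.map M i j := by
  conv_rhs => rw [← Φ.exists_dilation.choose_spec.2]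
  rfl

end LinearMaps

/-! ### States of fidelity one, and steering. -/

section Fidelity
variable {a b : Type} [Fintype a] [Fintype b]

/-- A Hermitian generalized inverse of a positive semidefinite matrix. -/
theorem exists_pseudoInverse [DecidableEq a] {ρ : Matrix a a ℂ} (hρ : ρ.PosSemidef) :
    ∃ R : Matrix a a ℂ, R.IsHermitian ∧ ρ * R * ρ = ρ ∧ R * ρ * R = R ∧ R * ρ = ρ * R := by
  have hH := hρ.isHermitian
  let D : a → ℂ := fun i => (hH.eigenvalues i : ℂ)
  let Q : Matrix a a ℂ := hH.eigenvectorUnitary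
  have hQ : Qᴴ * Q = 1 := Unitary.coe_star_mul_self hH.eigenvectorUnitary
  have hs : ρ = Q * diagonal D * Qᴴ := by
    have := hH.spectral_theorem
    rw [Unitary.conjStarAlgAut_apply] at this
    exact this
  have hc : ∀ d e : a → ℂ, (Q * diagonal d * Qᴴ) * (Q * diagonal e * Qᴴ) =
      Q * diagonal (fun i => d i * e i) * Qᴴ := by
    intro d e
    rw [← diagonal_mul_diagonal]
    calc _ = Q * diagonal d * (Qᴴ * Q) * diagonal e * Qᴴ := by simp only [Matrix.mul_assoc]
      _ = _ := by rw [hQ]; simp only [Matrix.mul_assoc, Matrix.one_mul]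
  have hD : ∀ i, D i * (D i)⁻¹ * D i = D i := fun i => mul_inv_mul_cancel (D i)
  -- With `0⁻¹ = 0` the kernel is left alone, so this is the Moore–Penrose inverse.
  refine ⟨Q * diagonal (fun i => (D i)⁻¹) * Qᴴ, ?_, ?_, ?_, ?_⟩
  · have : (fun i => (D i)⁻¹) = star (fun i => (D i)⁻¹) := by
      ext i; simp [D]
    rw [Matrix.IsHermitian, conjTranspose_mul, conjTranspose_mul, conjTranspose_conjTranspose,
      diagonal_conjTranspose, ← this, Matrix.mul_assoc]
  · rw [hs, hc, hc]; simp only [hD]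
  · rw [hs, hc, hc]
    congr 2; congr 1; ext i
    by_cases h : D i = 0
    · simp [h]
    · field_simp
  · rw [hs, hc, hc]; simp only [mul_comm]

theorem trace_conjTranspose_mul_self_eq_sum (A : Matrix a b ℂ) :
    (Aᴴ * A).trace = ((∑ i, ∑ j, ‖A i j‖ ^ 2 : ℝ) : ℂ) := by
  simp only [Matrix.trace, diag_apply, Matrix.mul_apply, conjTranspose_apply]
  rw [Finset.sum_comm]
  push_cast
  refine Finset.sum_congr rfl fun i _ => Finset.sum_congr rfl fun j _ => ?_
  exact Complex.conj_mul' (A i j)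

theorem eq_zero_of_trace_conjTranspose_mul_self_nonpos {A : Matrix a b ℂ}
    (h : (Aᴴ * A).trace.re ≤ 0) : A = 0 := by
  rw [trace_conjTranspose_mul_self_eq_sum, Complex.ofReal_re] at h
  have h0 : ∑ i, ∑ j, ‖A i j‖ ^ 2 = 0 := le_antisymm h (by positivity)
  ext i j
  have h1 := (Finset.sum_eq_zero_iff_of_nonneg (fun i _ => by positivity)).mp h0 i
    (Finset.mem_univ i)
  have h2 := (Finset.sum_eq_zero_iff_of_nonneg (fun i _ => by positivity)).mp h1 j
    (Finset.mem_univ j)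
  simpa using h2

open scoped MatrixOrder in
theorem fidelity_nonneg [DecidableEq a] (ρ σ : Matrix a a ℂ) : 0 ≤ fidelity ρ σ := by
  have h : (CFC.sqrt (CFC.sqrt ρ * σ * CFC.sqrt ρ)).PosSemidef :=
    Matrix.nonneg_iff_posSemidef.mp (CFC.sqrt_nonneg _)
  exact (Complex.nonneg_iff.mp h.trace_nonneg).1

open scoped MatrixOrder in
/-- States with fidelity one are equal. -/
theorem eq_of_one_le_fidelity [DecidableEq a] {ρ σ : Matrix a a ℂ} (hρ : ρ.PosSemidef)
    (hσ : σ.PosSemidef) (hρ1 : ρ.trace = 1) (hσ1 : σ.trace = 1) (h : 1 ≤ fidelity ρ σ) :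
    ρ = σ := by
  unfold fidelity at h
  set r := CFC.sqrt ρ with hr
  set s := CFC.sqrt σ with hs
  have rr : r * r = ρ := CFC.sqrt_mul_sqrt_self ρ (Matrix.nonneg_iff_posSemidef.mpr hρ)
  have ss : s * s = σ := CFC.sqrt_mul_sqrt_self σ (Matrix.nonneg_iff_posSemidef.mpr hσ)
  have hrH : rᴴ = r := (Matrix.nonneg_iff_posSemidef.mp (CFC.sqrt_nonneg ρ)).isHermitian
  have hsH : sᴴ = s := (Matrix.nonneg_iff_posSemidef.mp (CFC.sqrt_nonneg σ)).isHermitian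
  have hpos : (r * σ * r).PosSemidef := by
    have := hσ.mul_mul_conjTranspose_same r
    rwa [hrH] at this
  set P := CFC.sqrt (r * σ * r) with hP
  have PP : P * P = r * σ * r :=
    CFC.sqrt_mul_sqrt_self _ (Matrix.nonneg_iff_posSemidef.mpr hpos)
  have hPpos : P.PosSemidef := Matrix.nonneg_iff_posSemidef.mp (CFC.sqrt_nonneg _)
  obtain ⟨R, hRH, hR1, hR2, hR3⟩ := exists_pseudoInverse hPpos
  have hRH' : Rᴴ = R := hRH
  -- `C` is the partial isometry in the polar decomposition of `r * s`, whose positive part is `P`;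
  -- it attains the fidelity, `tr (C s r) = tr P`.
  let C := R * (r * s)
  have hCH : Cᴴ = s * r * R := by
    simp only [C, conjTranspose_mul, hRH', hrH, hsH]
  have hCC : C * Cᴴ = R * P := by
    calc C * Cᴴ = R * (r * (s * s) * r) * R := by rw [hCH]; simp only [C, Matrix.mul_assoc]
      _ = R * (P * P) * R := by rw [ss, PP]
      _ = R * P * (P * R) := by simp only [Matrix.mul_assoc]
      _ = R * P * R * P := by rw [← hR3]; simp only [Matrix.mul_assoc]
      _ = R * P := by rw [hR2]
  have hCCC : C * Cᴴ * C = C := by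
    rw [hCC]; simp only [C]; rw [← Matrix.mul_assoc, hR2]
  have hCs : (C * (s * r)).trace = P.trace := by
    congr 1
    calc C * (s * r) = R * (r * (s * s) * r) := by simp only [C, Matrix.mul_assoc]
      _ = R * (P * P) := by rw [ss, PP]
      _ = P * R * P := by rw [← Matrix.mul_assoc, hR3]
      _ = P := hR1
  -- the defect of the contraction `C` on `s`
  have hdef : 0 ≤ (((1 - Cᴴ * C) * s)ᴴ * ((1 - Cᴴ * C) * s)).trace.re := by
    rw [trace_conjTranspose_mul_self_eq_sum, Complex.ofReal_re]; positivity
  have hp2 : (1 - Cᴴ * C)ᴴ * (1 - Cᴴ * C) = 1 - Cᴴ * C := by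
    rw [conjTranspose_sub, conjTranspose_one, conjTranspose_mul, conjTranspose_conjTranspose]
    have : Cᴴ * C * (Cᴴ * C) = Cᴴ * C := by
      rw [Matrix.mul_assoc, ← Matrix.mul_assoc C, hCCC]
    rw [Matrix.mul_sub, Matrix.mul_one, Matrix.sub_mul, Matrix.one_mul, this]; simp
  have hdef' : (((1 - Cᴴ * C) * s)ᴴ * ((1 - Cᴴ * C) * s)).trace =
      1 - (s * Cᴴ * C * s).trace := by
    rw [conjTranspose_mul, hsH]
    calc _ = (s * ((1 - Cᴴ * C)ᴴ * (1 - Cᴴ * C)) * s).trace := by simp only [Matrix.mul_assoc]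
      _ = (s * s - s * Cᴴ * C * s).trace := by
        rw [hp2]; simp only [Matrix.mul_sub, Matrix.sub_mul, Matrix.mul_one, Matrix.mul_assoc]
      _ = _ := by rw [trace_sub, ss, hσ1]
  have hC1 : (r * C * s).trace = P.trace := by
    rw [Matrix.trace_mul_comm, ← Matrix.mul_assoc, Matrix.trace_mul_comm, hCs]
  have hC2 : (s * Cᴴ * r).trace = star P.trace := by
    rw [← hC1, ← trace_conjTranspose]
    simp only [conjTranspose_mul, hsH, hrH, Matrix.mul_assoc]
  -- In the Hilbert–Schmidt norm, `‖r - C s‖² = 1 - 2F + ‖C s‖² ≤ 2 - 2F ≤ 0`, where `‖C s‖ ≤ 1` is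
  -- `hdef`.
  have hdiff : r - C * s = 0 := by
    apply eq_zero_of_trace_conjTranspose_mul_self_nonpos
    have : (r - C * s)ᴴ * (r - C * s) = r * r - r * C * s - s * Cᴴ * r + s * Cᴴ * C * s := by
      rw [conjTranspose_sub, conjTranspose_mul, hrH, hsH]
      simp only [Matrix.mul_sub, Matrix.sub_mul, Matrix.mul_assoc]; abel
    rw [this, trace_add, trace_sub, trace_sub, rr, hρ1, hC1, hC2]
    rw [hdef'] at hdef
    simp only [Complex.sub_re, Complex.add_re, Complex.one_re, Complex.star_def,
      Complex.conj_re] at hdef ⊢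
    linarith
  have hrC : r = C * s := sub_eq_zero.mp hdiff
  have hρσ : ρ = s * Cᴴ * C * s := by
    calc ρ = rᴴ * r := by rw [hrH, rr]
      _ = (C * s)ᴴ * (C * s) := by rw [← hrC]
      _ = _ := by rw [conjTranspose_mul, hsH]; simp only [Matrix.mul_assoc]
  -- Now `‖C s‖² = tr ρ = 1`, so the defect vanishes and `Cᴴ C` can be dropped from `ρ = s Cᴴ C s`.
  have hz : (1 - Cᴴ * C) * s = 0 := by
    apply eq_zero_of_trace_conjTranspose_mul_self_nonpos
    rw [hdef', ← hρσ, hρ1]; simp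
  rw [hρσ, Matrix.mul_assoc s, Matrix.mul_assoc s, ← ss]
  rw [Matrix.sub_mul, Matrix.one_mul, sub_eq_zero] at hz
  rw [← hz]

/-- Positive semidefinite summands of `Mᴴ M` come from a resolution of the identity: any ensemble
of the reduced state can be steered to by a measurement of the purifying register. -/
theorem exists_povm_of_sum_eq [DecidableEq a] {ι : Type} [Fintype ι] [Nonempty ι] (M : Matrix a b ℂ)
    {σ : ι → Matrix b b ℂ} (hσ : ∀ i, (σ i).PosSemidef) (hsum : ∑ i, σ i = Mᴴ * M) :
    ∃ E : ι → Matrix a a ℂ, (∀ i, (E i).PosSemidef) ∧ ∑ i, E i = 1 ∧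
      ∀ i, Mᴴ * E i * M = σ i := by
  classical
  obtain ⟨R, hRH, hR1, hR2, hR3⟩ := exists_pseudoInverse (posSemidef_conjTranspose_mul_self M)
  have hRH' : Rᴴ = R := hRH
  have hker : M * R * (Mᴴ * M) = M := by
    have : M * R * (Mᴴ * M) - M = 0 := by
      rw [← Matrix.conjTranspose_mul_self_eq_zero]
      rw [conjTranspose_sub, Matrix.sub_mul, Matrix.mul_sub, Matrix.mul_sub]
      have h1 : Mᴴ * (M * R * (Mᴴ * M)) = Mᴴ * M := by
        calc _ = Mᴴ * M * R * (Mᴴ * M) := by simp only [Matrix.mul_assoc]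
          _ = _ := hR1
      have h2 : (M * R * (Mᴴ * M))ᴴ = Mᴴ * M * R * Mᴴ := by
        simp only [conjTranspose_mul, conjTranspose_conjTranspose, hRH', Matrix.mul_assoc]
      rw [h1, h2]
      have h3 : Mᴴ * M * R * Mᴴ * (M * R * (Mᴴ * M)) = Mᴴ * M := by
        calc _ = Mᴴ * M * R * (Mᴴ * (M * R * (Mᴴ * M))) := by simp only [Matrix.mul_assoc]
          _ = _ := by rw [h1, hR1]
      have h4 : Mᴴ * M * R * Mᴴ * M = Mᴴ * M := by
        rw [Matrix.mul_assoc _ Mᴴ, hR1]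
      rw [h3, h4]; simp
    exact sub_eq_zero.mp this
  -- The kernel of `M` lies in the kernel of each `σ i`: `N` maps into the former, and the positive
  -- semidefinite `Nᴴ σ j N` sum to zero.
  have hσR : ∀ i, σ i * R * (Mᴴ * M) = σ i := by
    intro i
    let N := 1 - R * (Mᴴ * M)
    have hN : M * N = 0 := by
      simp only [N]; rw [Matrix.mul_sub, Matrix.mul_one, ← Matrix.mul_assoc, hker, sub_self]
    have hsumN : ∑ j, Nᴴ * σ j * N = 0 := by
      rw [← Matrix.sum_mul, ← Matrix.mul_sum, hsum, Matrix.mul_assoc, Matrix.mul_assoc, hN]; simp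
    have hi : Nᴴ * σ i * N = 0 := by
      have hnn : ∀ j, (Nᴴ * σ j * N).PosSemidef := fun j => (hσ j).conjTranspose_mul_mul_same N
      rw [← (hnn i).trace_eq_zero_iff]
      have ht := congrArg Matrix.trace hsumN
      rw [Matrix.trace_sum, Matrix.trace_zero,
        Finset.sum_eq_zero_iff_of_nonneg fun j _ => (hnn j).trace_nonneg] at ht
      exact ht i (Finset.mem_univ i)
    obtain ⟨S, hS⟩ := exists_eq_conjTranspose_mul_self (hσ i)
    have hSN : S * N = 0 := by
      rw [← Matrix.conjTranspose_mul_self_eq_zero, conjTranspose_mul]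
      rw [hS] at hi
      simpa only [Matrix.mul_assoc] using hi
    have : σ i * N = 0 := by rw [hS, Matrix.mul_assoc, hSN, Matrix.mul_zero]
    simp only [N] at this
    rw [Matrix.mul_sub, Matrix.mul_one, sub_eq_zero, ← Matrix.mul_assoc] at this
    exact this.symm
  have hσR' : ∀ i, Mᴴ * M * R * σ i = σ i := by
    intro i
    have := congrArg conjTranspose (hσR i)
    have hi : (σ i)ᴴ = σ i := (hσ i).isHermitian
    simpa only [conjTranspose_mul, conjTranspose_conjTranspose, hi, hRH', Matrix.mul_assoc]
      using this
  -- The orthogonal projection onto the range of `M`.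
  let Q := M * R * Mᴴ
  have hQH : Qᴴ = Q := by
    simp only [Q, conjTranspose_mul, conjTranspose_conjTranspose, hRH', Matrix.mul_assoc]
  have hQQ : Q * Q = Q := by
    calc Q * Q = M * (R * (Mᴴ * M) * R) * Mᴴ := by simp only [Q, Matrix.mul_assoc]
      _ = Q := by rw [hR2]
  have hQM : Q * M = M := by
    simp only [Q]; rw [Matrix.mul_assoc, hker]
  have hpos : (1 - Q).PosSemidef := by
    have : (1 - Q)ᴴ * (1 - Q) = 1 - Q := by
      rw [conjTranspose_sub, conjTranspose_one, hQH, Matrix.mul_sub, Matrix.mul_one,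
        Matrix.sub_mul, Matrix.one_mul, hQQ]; simp
    rw [← this]; exact posSemidef_conjTranspose_mul_self _
  let i₀ : ι := Classical.arbitrary ι
  -- The first summands add up only to `Q`. The missing `1 - Q` goes to an arbitrary outcome, which
  -- is harmless because it annihilates `M`.
  refine ⟨fun i => M * R * σ i * R * Mᴴ + if i = i₀ then 1 - Q else 0, fun i => ?_, ?_, fun i => ?_⟩
  · refine PosSemidef.add ?_ ?_
    · have := (hσ i).mul_mul_conjTranspose_same (M * R)
      simpa only [conjTranspose_mul, hRH', Matrix.mul_assoc] using this
    · split_ifs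
      · exact hpos
      · exact PosSemidef.zero
  · rw [Finset.sum_add_distrib, Finset.sum_ite_eq' Finset.univ i₀]
    simp only [Finset.mem_univ, if_true]
    have : ∑ i, M * R * σ i * R * Mᴴ = Q := by
      rw [← Matrix.sum_mul, ← Matrix.sum_mul, ← Matrix.mul_sum, hsum, Matrix.mul_assoc M,
        Matrix.mul_assoc M, hR2]
    rw [this]; simp
  · have h0 : Mᴴ * (if i = i₀ then 1 - Q else 0) * M = 0 := by
      split_ifs
      · rw [Matrix.mul_assoc, Matrix.sub_mul, Matrix.one_mul, hQM, sub_self, Matrix.mul_zero]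
      · simp
    rw [Matrix.mul_add, Matrix.add_mul, h0, add_zero]
    calc _ = (Mᴴ * M * R * σ i) * R * (Mᴴ * M) := by simp only [Matrix.mul_assoc]
      _ = σ i := by rw [hσR', hσR]

end Fidelity

/-! ### Dilated channels acting beside an old environment. -/

section Dilation

variable {a b a' b' E : Type} [Fintype a] [Fintype b] [Fintype a'] [Fintype b'] [Fintype E]

/-- The dilation of a channel, applied in the presence of a further register `E`. -/
noncomputable def Channel.dilate (Φ : Channel a b) (α : a' ≃ a × E)
    (β : (b × (a × b)) × E ≃ b') : Channel a' b' :=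
  Channel.ofKraus (relabel β ∘ₗ tensorId E Φ.dilation.map ∘ₗ relabel α)
    ((isConj_relabel β).comp ((Φ.isConj_dilation.tensorId E).comp (isConj_relabel α))).hasKraus
    ((isTP_relabel β).comp ((Φ.dilation.isTP.tensorId E).comp (isTP_relabel α)))

theorem Channel.isConj_dilate (Φ : Channel a b) (α : a' ≃ a × E)
    (β : (b × (a × b)) × E ≃ b') : IsConj (Φ.dilate α β).map :=
  (isConj_relabel β).comp ((Φ.isConj_dilation.tensorId E).comp (isConj_relabel α))

/-- Discarding the new and old environments after the dilation amounts to discarding the old one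
before `Φ`. This is the commuting square that each round of the simulation needs. -/
theorem Channel.sum_dilate (Φ : Channel a b) (α : a' ≃ a × E) (β : (b × (a × b)) × E ≃ b')
    (M : Matrix a' a' ℂ) (i j : b) :
    ∑ p : (a × b) × E, (Φ.dilate α β).map M (β ((i, p.1), p.2)) (β ((j, p.1), p.2)) =
      Φ.map (Matrix.of fun x y => ∑ e, M (α.symm (x, e)) (α.symm (y, e))) i j := by
  have h : (Matrix.of fun x y => ∑ e, M (α.symm (x, e)) (α.symm (y, e))) =
      ∑ e, Matrix.of fun x y => M (α.symm (x, e)) (α.symm (y, e)) := by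
    ext x y; simp [Matrix.sum_apply]
  rw [h, map_sum, Matrix.sum_apply, Fintype.sum_prod_type_right]
  refine Finset.sum_congr rfl fun e _ => ?_
  rw [← Φ.sum_dilation]
  refine Finset.sum_congr rfl fun m _ => ?_
  simp only [Channel.dilate, Channel.ofKraus, LinearMap.comp_apply, relabel_apply, tensorId_apply,
    Equiv.symm_apply_apply]

/-- Regrouping of registers, `(a b) c` to `(a c) b`. -/
def swapRight (a b c : Type) : (a × b) × c ≃ (a × c) × b where
  toFun x := ((x.1.1, x.2), x.1.2)
  invFun x := ((x.1.1, x.2), x.1.2)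
  left_inv _ := rfl
  right_inv _ := rfl

end Dilation

/-! ### Purified strategies and their executions. -/

section Strategies

variable {I : Interface} {U V X Y X' Y' : Type} [Fintype U] [Fintype V] [Fintype X] [Fintype Y]
  [Fintype X'] [Fintype Y']

/-- The environment accumulated by the dilations of Alice's channels. -/
def AliceStrategy.env (A : AliceStrategy I U X) : ℕ → Type
  -- The factor `Unit` is the empty past, which makes the first channel an instance of
  -- `Channel.dilate` as well.
  | 0 => (U × (A.mem 0 × I.toBob 0)) × Unit
  | i + 1 => ((A.mem i × I.toAlice i) × (A.mem (i + 1) × I.toBob (i + 1))) × A.env i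

noncomputable instance AliceStrategy.fintypeEnv (A : AliceStrategy I U X) :
    ∀ i, Fintype (A.env i)
  | 0 => inferInstanceAs (Fintype ((U × (A.mem 0 × I.toBob 0)) × Unit))
  | i + 1 =>
    have := A.fintypeEnv i
    inferInstanceAs (Fintype
      (((A.mem i × I.toAlice i) × (A.mem (i + 1) × I.toBob (i + 1))) × A.env i))

/-- The environment accumulated by the dilations of Bob's channels. -/
def BobStrategy.env (B : BobStrategy I V Y) : ℕ → Type
  | 0 => (V × B.mem 0) × Unit
  | i + 1 => ((I.toBob i × B.mem i) × (I.toAlice i × B.mem (i + 1))) × B.env i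

noncomputable instance BobStrategy.fintypeEnv (B : BobStrategy I V Y) :
    ∀ i, Fintype (B.env i)
  | 0 => inferInstanceAs (Fintype ((V × B.mem 0) × Unit))
  | i + 1 =>
    have := B.fintypeEnv i
    inferInstanceAs (Fintype
      (((I.toBob i × B.mem i) × (I.toAlice i × B.mem (i + 1))) × B.env i))

/-- The environment of a purified strategy of Alice at the end of the protocol. -/
abbrev AliceStrategy.finalEnv (A : AliceStrategy I U X) : Type :=
  (A.mem I.rounds × X) × A.env I.rounds

/-- The environment of a purified strategy of Bob at the end of the protocol. -/
abbrev BobStrategy.finalEnv (B : BobStrategy I V Y) : Type :=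
  ((I.toBob I.rounds × B.mem I.rounds) × Y) × B.env I.rounds

/-- Alice's strategy with all channels dilated; she keeps the environment. -/
noncomputable def AliceStrategy.purify (A : AliceStrategy I U X) :
    AliceStrategy I U (X × A.finalEnv) where
  mem i := A.mem i × A.env i
  decEqMem _ := Classical.decEq _
  init := A.init.dilate (Equiv.prodPUnit U).symm
    ((Equiv.prodAssoc _ _ _).trans (swapRight (A.mem 0) (I.toBob 0) (A.env 0)))
  step i := (A.step i).dilate (swapRight (A.mem i) (A.env i) (I.toAlice i))
    ((Equiv.prodAssoc _ _ _).trans (swapRight (A.mem (i + 1)) (I.toBob (i + 1)) (A.env (i + 1))))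
  final := A.final.dilate (Equiv.refl _) (Equiv.prodAssoc _ _ _)

/-- Bob's strategy with all channels dilated; he keeps the environment. -/
noncomputable def BobStrategy.purify (B : BobStrategy I V Y) :
    BobStrategy I V (Y × B.finalEnv) where
  mem i := B.mem i × B.env i
  decEqMem _ := Classical.decEq _
  init := B.init.dilate (Equiv.prodPUnit V).symm (Equiv.prodAssoc (B.mem 0) (V × B.mem 0) Unit)
  step i := (B.step i).dilate (Equiv.prodAssoc (I.toBob i) (B.mem i) (B.env i)).symm
    ((Equiv.prodAssoc _ _ _).trans
      (Equiv.prodAssoc (I.toAlice i) (B.mem (i + 1)) (B.env (i + 1))))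
  final := B.final.dilate (Equiv.prodAssoc _ _ _).symm (Equiv.prodAssoc _ _ _)

/-! ### Simulation -/

/-- The maps `τ i` translate one memory of Alice into the other. They pass through her own channels
by hypothesis, and through Bob's because they act on different registers. -/
theorem tensorId_runTo_of_simulates {A : AliceStrategy I U X} {A' : AliceStrategy I U X'}
    (B : BobStrategy I V Y)
    (τ : ∀ i, Matrix (A'.mem i) (A'.mem i) ℂ →ₗ[ℂ] Matrix (A.mem i) (A.mem i) ℂ)
    (h0 : tensorId (I.toBob 0) (τ 0) ∘ₗ A'.init.map = A.init.map)
    (hs : ∀ i, tensorId (I.toBob (i + 1)) (τ (i + 1)) ∘ₗ (A'.step i).map =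
      (A.step i).map ∘ₗ tensorId (I.toAlice i) (τ i)) (i : ℕ) :
    tensorId (B.mem i) (tensorId (I.toBob i) (τ i)) ∘ₗ runTo A' B i = runTo A B i := by
  induction i with
  | zero =>
    simp only [runTo]
    rw [← h0]
    rfl
  | succ i ih =>
    have hc := tensorId_comp_idTensor (τ i) (B.step i).map
    simp only [runTo]
    rw [← ih]
    calc _ = tensorId (B.mem (i + 1)) (tensorId (I.toBob (i + 1)) (τ (i + 1)) ∘ₗ
            (A'.step i).map) ∘ₗ regroupLeft _ _ _ ∘ₗ idTensor (A'.mem i) (B.step i).map ∘ₗ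
            regroupRight _ _ _ ∘ₗ runTo A' B i := rfl
      _ = tensorId (B.mem (i + 1)) (A.step i).map ∘ₗ regroupLeft _ _ _ ∘ₗ
            (tensorId (I.toAlice i × B.mem (i + 1)) (τ i) ∘ₗ
              idTensor (A'.mem i) (B.step i).map) ∘ₗ
            regroupRight _ _ _ ∘ₗ runTo A' B i := by rw [hs]; rfl
      _ = _ := by rw [hc]; rfl

theorem tensorId_run_of_simulates {A : AliceStrategy I U X} {A' : AliceStrategy I U X'}
    (B : BobStrategy I V Y)
    (τ : ∀ i, Matrix (A'.mem i) (A'.mem i) ℂ →ₗ[ℂ] Matrix (A.mem i) (A.mem i) ℂ)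
    (τf : Matrix X' X' ℂ →ₗ[ℂ] Matrix X X ℂ)
    (h0 : tensorId (I.toBob 0) (τ 0) ∘ₗ A'.init.map = A.init.map)
    (hs : ∀ i, tensorId (I.toBob (i + 1)) (τ (i + 1)) ∘ₗ (A'.step i).map =
      (A.step i).map ∘ₗ tensorId (I.toAlice i) (τ i))
    (hf : τf ∘ₗ A'.final.map = A.final.map ∘ₗ τ I.rounds) :
    tensorId Y τf ∘ₗ run A' B = run A B := by
  have hc := tensorId_comp_idTensor (τ I.rounds) B.final.map
  simp only [run]
  rw [← tensorId_runTo_of_simulates B τ h0 hs]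
  calc _ = tensorId Y (τf ∘ₗ A'.final.map) ∘ₗ idTensor (A'.mem I.rounds) B.final.map ∘ₗ
          regroupRight _ _ _ ∘ₗ runTo A' B I.rounds := rfl
    _ = tensorId Y A.final.map ∘ₗ (tensorId Y (τ I.rounds) ∘ₗ
          idTensor (A'.mem I.rounds) B.final.map) ∘ₗ
          regroupRight _ _ _ ∘ₗ runTo A' B I.rounds := by rw [hf]; rfl
    _ = _ := by rw [hc]; rfl

theorem idTensor_runTo_of_simulates (A : AliceStrategy I U X) {B : BobStrategy I V Y}
    {B' : BobStrategy I V Y'}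
    (τ : ∀ i, Matrix (B'.mem i) (B'.mem i) ℂ →ₗ[ℂ] Matrix (B.mem i) (B.mem i) ℂ)
    (h0 : τ 0 ∘ₗ B'.init.map = B.init.map)
    (hs : ∀ i, idTensor (I.toAlice i) (τ (i + 1)) ∘ₗ (B'.step i).map =
      (B.step i).map ∘ₗ idTensor (I.toBob i) (τ i)) (i : ℕ) :
    idTensor (A.mem i × I.toBob i) (τ i) ∘ₗ runTo A B' i = runTo A B i := by
  induction i with
  | zero =>
    simp only [runTo]
    rw [← h0, ← LinearMap.comp_assoc, ← tensorId_comp_idTensor]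
    rfl
  | succ i ih =>
    have hc := tensorId_comp_idTensor (A.step i).map (τ (i + 1))
    simp only [runTo]
    rw [← ih]
    calc _ = (idTensor (A.mem (i + 1) × I.toBob (i + 1)) (τ (i + 1)) ∘ₗ
            tensorId (B'.mem (i + 1)) (A.step i).map) ∘ₗ regroupLeft _ _ _ ∘ₗ
            idTensor (A.mem i) (B'.step i).map ∘ₗ regroupRight _ _ _ ∘ₗ runTo A B' i := rfl
      _ = tensorId (B.mem (i + 1)) (A.step i).map ∘ₗ regroupLeft _ _ _ ∘ₗ
            idTensor (A.mem i) (idTensor (I.toAlice i) (τ (i + 1)) ∘ₗ (B'.step i).map) ∘ₗ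
            regroupRight _ _ _ ∘ₗ runTo A B' i := by rw [← hc]; rfl
      _ = _ := by rw [hs]; rfl

theorem idTensor_run_of_simulates (A : AliceStrategy I U X) {B : BobStrategy I V Y}
    {B' : BobStrategy I V Y'}
    (τ : ∀ i, Matrix (B'.mem i) (B'.mem i) ℂ →ₗ[ℂ] Matrix (B.mem i) (B.mem i) ℂ)
    (τf : Matrix Y' Y' ℂ →ₗ[ℂ] Matrix Y Y ℂ)
    (h0 : τ 0 ∘ₗ B'.init.map = B.init.map)
    (hs : ∀ i, idTensor (I.toAlice i) (τ (i + 1)) ∘ₗ (B'.step i).map =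
      (B.step i).map ∘ₗ idTensor (I.toBob i) (τ i))
    (hf : τf ∘ₗ B'.final.map = B.final.map ∘ₗ idTensor (I.toBob I.rounds) (τ I.rounds)) :
    idTensor X τf ∘ₗ run A B' = run A B := by
  have hc := tensorId_comp_idTensor A.final.map τf
  simp only [run]
  rw [← idTensor_runTo_of_simulates A τ h0 hs]
  calc _ = (idTensor X τf ∘ₗ tensorId Y' A.final.map) ∘ₗ
          idTensor (A.mem I.rounds) B'.final.map ∘ₗ
          regroupRight _ _ _ ∘ₗ runTo A B' I.rounds := rfl
    _ = tensorId Y A.final.map ∘ₗ idTensor (A.mem I.rounds) (τf ∘ₗ B'.final.map) ∘ₗ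
          regroupRight _ _ _ ∘ₗ runTo A B' I.rounds := by rw [← hc]; rfl
    _ = _ := by rw [hf]; rfl

/-- Take for `τ i` the partial trace over the environment accumulated so far; every intertwining
condition is then `Channel.sum_dilate`. -/
theorem tensorId_traceRight_run_purify (A : AliceStrategy I U X) (B : BobStrategy I V Y) :
    tensorId Y (traceRight X A.finalEnv) ∘ₗ run A.purify B = run A B := by
  refine tensorId_run_of_simulates B (fun i => traceRight (A.mem i) (A.env i)) _ ?_
    (fun i => ?_) ?_
  · refine LinearMap.ext fun M => ?_
    ext i j
    refine (A.init.sum_dilate (Equiv.prodPUnit U).symm _ M i j).trans ?_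
    simp
    rfl
  · refine LinearMap.ext fun M => ?_
    ext k l
    exact (A.step i).sum_dilate _ _ M k l
  · refine LinearMap.ext fun M => ?_
    ext k l
    exact A.final.sum_dilate _ _ M k l

theorem idTensor_traceRight_run_purify (A : AliceStrategy I U X) (B : BobStrategy I V Y) :
    idTensor X (traceRight Y B.finalEnv) ∘ₗ run A B.purify = run A B := by
  refine idTensor_run_of_simulates A (fun i => traceRight (B.mem i) (B.env i)) _ ?_
    (fun i => ?_) ?_
  · refine LinearMap.ext fun M => ?_
    ext i j
    refine (B.init.sum_dilate (Equiv.prodPUnit V).symm _ M i j).trans ?_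
    simp
    rfl
  · refine LinearMap.ext fun M => ?_
    ext k l
    exact (B.step i).sum_dilate _ _ M k l
  · refine LinearMap.ext fun M => ?_
    ext k l
    exact B.final.sum_dilate _ _ M k l

/-! ### Properties of executions -/

/-- With both parties purified nothing is ever discarded, so each step has a single Kraus operator
and so does their composition. -/
theorem isConj_runTo_purify (A : AliceStrategy I U X) (B : BobStrategy I V Y) (i : ℕ) :
    IsConj (runTo A.purify B.purify i) := by
  induction i with
  | zero =>
    exact ((A.init.isConj_dilate _ _).tensorId _).comp ((B.init.isConj_dilate _ _).idTensor _)
  | succ i ih =>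
    exact (((A.step i).isConj_dilate _ _).tensorId _).comp ((isConj_relabel _).comp
      ((((B.step i).isConj_dilate _ _).idTensor _).comp ((isConj_relabel _).comp ih)))

theorem isConj_run_purify (A : AliceStrategy I U X) (B : BobStrategy I V Y) :
    IsConj (run A.purify B.purify) :=
  ((A.final.isConj_dilate _ _).tensorId _).comp (((B.final.isConj_dilate _ _).idTensor _).comp
    ((isConj_relabel _).comp (isConj_runTo_purify A B _)))

theorem hasKraus_run (A : AliceStrategy I U X) (B : BobStrategy I V Y) :
    HasKraus (run A B) := by
  have h : ∀ i, HasKraus (runTo A B i) := by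
    intro i
    induction i with
    | zero => exact (A.init.hasKraus.tensorId _).comp (B.init.hasKraus.idTensor _)
    | succ i ih =>
      exact ((A.step i).hasKraus.tensorId _).comp ((isConj_relabel _).hasKraus.comp
        (((B.step i).hasKraus.idTensor _).comp ((isConj_relabel _).hasKraus.comp ih)))
  exact (A.final.hasKraus.tensorId _).comp ((B.final.hasKraus.idTensor _).comp
    ((isConj_relabel _).hasKraus.comp (h _)))

theorem isTP_run (A : AliceStrategy I U X) (B : BobStrategy I V Y) : IsTP (run A B) := by
  have h : ∀ i, IsTP (runTo A B i) := by
    intro i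
    induction i with
    | zero => exact (A.init.isTP.tensorId _).comp (B.init.isTP.idTensor _)
    | succ i ih =>
      exact ((A.step i).isTP.tensorId _).comp ((isTP_relabel _).comp
        (((B.step i).isTP.idTensor _).comp ((isTP_relabel _).comp ih)))
  exact (A.final.isTP.tensorId _).comp ((B.final.isTP.idTensor _).comp
    ((isTP_relabel _).comp (h _)))

end Strategies

/-! ### From distance zero on one entangled input to equality of maps. -/

section PerfectCloseness

theorem eq_of_purifiedDistance_nonpos {a : Type} [Fintype a] [DecidableEq a] {ρ σ : Matrix a a ℂ}
    (hρ : ρ.PosSemidef) (hσ : σ.PosSemidef) (hρ1 : ρ.trace = 1) (hσ1 : σ.trace = 1)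
    (h : purifiedDistance ρ σ ≤ 0) : ρ = σ := by
  refine eq_of_one_le_fidelity hρ hσ hρ1 hσ1 ?_
  have h1 : 1 - fidelity ρ σ ^ 2 ≤ 0 :=
    Real.sqrt_eq_zero'.mp (le_antisymm h (Real.sqrt_nonneg _))
  nlinarith [fidelity_nonneg ρ σ]

theorem posSemidef_purifiedInput {W : Type} [Fintype W] [DecidableEq W] (p : W → ℝ) :
    (purifiedInput p).PosSemidef := posSemidef_vecMulVec_self_star _

theorem trace_purifiedInput {W : Type} [Fintype W] [DecidableEq W] {p : W → ℝ}
    (hp : p ∈ stdSimplex ℝ W) : (purifiedInput p).trace = 1 := by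
  have h : ∀ w, (√(p w) : ℂ) * √(p w) = p w := fun w => by
    rw [← Complex.ofReal_mul, Real.mul_self_sqrt (hp.1 w)]
  simp [Matrix.trace, purifiedInput, vecMulVec_apply, Fintype.sum_prod_type, h]
  exact_mod_cast hp.2

/-- The uniform distribution. -/
noncomputable def uniform (W : Type) [Fintype W] : W → ℝ := fun _ => (Fintype.card W : ℝ)⁻¹

theorem uniform_mem_stdSimplex (W : Type) [Fintype W] [Nonempty W] :
    uniform W ∈ stdSimplex ℝ W := by
  refine ⟨fun w => by unfold uniform; positivity, ?_⟩
  simp [uniform]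

/-- Maps that are perfectly close on the purification of the uniform distribution are equal. -/
theorem map_eq_of_purifiedDistance_nonpos {W b : Type} [Fintype W] [DecidableEq W] [Nonempty W]
    [Fintype b] [DecidableEq b] {Φ Ψ : Matrix W W ℂ →ₗ[ℂ] Matrix b b ℂ}
    (hΦ : HasKraus Φ) (hΨ : HasKraus Ψ) (tΦ : IsTP Φ) (tΨ : IsTP Ψ)
    (h : purifiedDistance (idTensor W Φ (purifiedInput (uniform W)))
      (idTensor W Ψ (purifiedInput (uniform W))) ≤ 0) : Φ = Ψ := by
  have hp := posSemidef_purifiedInput (uniform W)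
  have ht := trace_purifiedInput (uniform_mem_stdSimplex W)
  have he := eq_of_purifiedDistance_nonpos ((hΦ.idTensor W).posSemidef hp)
    ((hΨ.idTensor W).posSemidef hp) ((tΦ.idTensor W _).trans ht) ((tΨ.idTensor W _).trans ht) h
  have hc : ((Fintype.card W : ℂ)⁻¹) ≠ 0 := inv_ne_zero (Nat.cast_ne_zero.mpr Fintype.card_ne_zero)
  -- Every block of the uniform purification is the same nonzero multiple of a matrix unit, so the
  -- blocks of the output state display the map on all matrix units.
  have key : ∀ x y : W, (Matrix.of fun i j => purifiedInput (uniform W) (x, i) (y, j)) =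
      (Fintype.card W : ℂ)⁻¹ • Matrix.single x y 1 := by
    intro x y
    have hs : ((√(uniform W x) : ℝ) : ℂ) * ((√(uniform W y) : ℝ) : ℂ) = (Fintype.card W : ℂ)⁻¹ := by
      rw [← Complex.ofReal_mul]
      simp only [uniform]
      rw [Real.mul_self_sqrt (by positivity)]
      push_cast; rfl
    ext i j
    simp only [purifiedInput, Matrix.of_apply, vecMulVec_apply, Pi.star_apply, Matrix.smul_apply,
      Matrix.single_apply, smul_eq_mul, ite_and]
    split_ifs
    · simpa using hs
    all_goals simp
  refine LinearMap.ext fun M => ?_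
  ext i j
  rw [map_eq_sum_single Φ, map_eq_sum_single Ψ]
  refine Finset.sum_congr rfl fun x _ => Finset.sum_congr rfl fun y _ => ?_
  have h1 := congrFun (congrFun he (x, i)) (y, j)
  simp only [idTensor_apply] at h1
  rw [key, map_smul, map_smul, Matrix.smul_apply, Matrix.smul_apply, smul_eq_mul, smul_eq_mul] at h1
  rw [mul_left_cancel₀ hc h1]

end PerfectCloseness

/-! ### The ideal execution, split by the input sent to the functionality. -/

section IdealWorld

variable {U V Z Y : Type}

/-- The branch of the ideal functionality in which Bob's input is found to be `w`. -/
def idealBranch [Fintype U] [DecidableEq Z] (f : U → V → Z) (w : V) :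
    Matrix (U × V) (U × V) ℂ →ₗ[ℂ] Matrix (Z × Z) (Z × Z) ℂ :=
  ∑ u : U, (Matrix.singleLinearMap ℂ (f u w, f u w) (f u w, f u w)) ∘ₗ
    Matrix.entryLinearMap ℂ ℂ (u, w) (u, w)

theorem idealBranch_apply [Fintype U] [DecidableEq Z] (f : U → V → Z) (w : V)
    (M : Matrix (U × V) (U × V) ℂ) (i j : Z × Z) :
    idealBranch f w M i j =
      ∑ u, Matrix.single (f u w, f u w) (f u w, f u w) (M (u, w) (u, w)) i j := by
  simp [idealBranch, LinearMap.sum_apply, Matrix.sum_apply]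

theorem idealFunctionality_eq_sum [Fintype U] [Fintype V] [DecidableEq Z] (f : U → V → Z) :
    idealFunctionality f = ∑ w, idealBranch f w := by
  simp only [idealFunctionality, idealBranch, Fintype.sum_prod_type_right]

theorem hasKraus_idealBranch [Fintype U] [Fintype V] [DecidableEq Z] (f : U → V → Z)
    (w : V) : HasKraus (idealBranch f w) := by
  classical
  refine HasKraus.sum fun u => IsConj.hasKraus
    ⟨Matrix.single (f u w, f u w) (u, w) 1, LinearMap.ext fun M => ?_⟩
  simp [conjMap_apply, Matrix.single_mul_mul_single]

variable [Fintype U] [Fintype V] [Fintype Z] [Fintype Y]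

theorem isTP_idealFunctionality [DecidableEq Z] (f : U → V → Z) : IsTP (idealFunctionality f) := by
  intro M
  rw [idealFunctionality, LinearMap.sum_apply, Matrix.trace_sum]
  simp [Matrix.trace]

/-- The branch of an ideal execution in which the functionality receives `w` from Bob. -/
def idealRunBranch [DecidableEq Z] (f : U → V → Z) (B : IdealBob V Z Y) (w : V) :
    Matrix (U × V) (U × V) ℂ →ₗ[ℂ] Matrix (Z × Y) (Z × Y) ℂ :=
  idTensor Z B.post.map ∘ₗ regroupRight Z Z B.K ∘ₗ
    tensorId B.K (idealBranch f w) ∘ₗ regroupLeft U V B.K ∘ₗ idTensor U B.pre.map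

theorem idealRun_eq_sum [DecidableEq Z] (f : U → V → Z) (B : IdealBob V Z Y) :
    idealRun f B = ∑ w, idealRunBranch f B w := by
  refine LinearMap.ext fun M => ?_
  simp only [idealRun, idealRunBranch, idealFunctionality_eq_sum, tensorId_sum,
    LinearMap.comp_apply, LinearMap.sum_apply, map_sum]

theorem hasKraus_idealRunBranch [DecidableEq Z] (f : U → V → Z) (B : IdealBob V Z Y) (w : V) :
    HasKraus (idealRunBranch f B w) :=
  (B.post.hasKraus.idTensor _).comp ((isConj_relabel _).hasKraus.comp
    (((hasKraus_idealBranch f w).tensorId _).comp ((isConj_relabel _).hasKraus.comp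
      (B.pre.hasKraus.idTensor _))))

theorem hasKraus_idealRun [DecidableEq Z] (f : U → V → Z) (B : IdealBob V Z Y) :
    HasKraus (idealRun f B) := by
  rw [idealRun_eq_sum]
  exact HasKraus.sum fun w => hasKraus_idealRunBranch f B w

theorem isTP_idealRun [DecidableEq Z] (f : U → V → Z) (B : IdealBob V Z Y) : IsTP (idealRun f B) :=
  (B.post.isTP.idTensor _).comp ((isTP_relabel _).comp
    (((isTP_idealFunctionality f).tensorId _).comp ((isTP_relabel _).comp
      (B.pre.isTP.idTensor _))))

/-- The probability that an ideal adversary with input `v` sends `w` to the functionality. -/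
def IdealBob.inputProb [DecidableEq V] (B : IdealBob V Z Y) (v w : V) : ℂ :=
  ∑ k, B.pre.map (Matrix.single v v 1) (w, k) (w, k)

theorem IdealBob.inputProb_nonneg [DecidableEq V] (B : IdealBob V Z Y) (v w : V) :
    0 ≤ B.inputProb v w := by
  have h : (B.pre.map (Matrix.single v v 1)).PosSemidef := by
    refine B.pre.hasKraus.posSemidef ?_
    have := posSemidef_vecMulVec_self_star (Pi.single v (1 : ℂ))
    rwa [← Pi.single_star, star_one, ← Matrix.single_eq_single_vecMulVec_single] at this
  exact Finset.sum_nonneg fun k _ => h.diag_nonneg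

theorem IdealBob.sum_inputProb [DecidableEq V] (B : IdealBob V Z Y) (v : V) :
    ∑ w, B.inputProb v w = 1 := by
  have h := B.pre.isTP (Matrix.single v v 1)
  rw [Matrix.trace_single_eq_same] at h
  rw [← h, Matrix.trace, Fintype.sum_prod_type]
  rfl

/-- Summing over Bob's output removes `B.post`, which preserves the trace. What remains is the
weight of sending `w`, which does not involve `u`, with Alice's output fixed to `f u w`. -/
theorem sum_idealRunBranch_single [DecidableEq Z] [DecidableEq U] [DecidableEq V] (f : U → V → Z)
    (B : IdealBob V Z Y) (u : U) (v w : V) (z : Z) :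
    ∑ y, idealRunBranch f B w (Matrix.single (u, v) (u, v) 1) (z, y) (z, y) =
      if f u w = z then B.inputProb v w else 0 := by
  simp only [idealRunBranch, LinearMap.comp_apply, idTensor_apply]
  have hs : ∀ u' : U, (Matrix.of fun x y =>
      (Matrix.single (u, v) (u, v) (1 : ℂ) : Matrix (U × V) (U × V) ℂ) (u', x) (u', y)) =
      if u = u' then Matrix.single v v 1 else 0 := by
    intro u'
    ext x y
    by_cases h : u = u' <;> simp [Matrix.single_apply, h]
  refine (B.post.isTP _).trans ?_
  simp only [Matrix.trace, Matrix.diag_apply, Fintype.sum_prod_type, Matrix.of_apply,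
    regroupRight_apply, tensorId_apply, idealBranch_apply, regroupLeft_apply, idTensor_apply, hs]
  simp only [IdealBob.inputProb]
  rw [Finset.sum_comm]
  have : ∀ k z', ∑ u', (Matrix.single (f u' w, f u' w) (f u' w, f u' w)
      (B.pre.map (if u = u' then Matrix.single v v 1 else 0) (w, k) (w, k)) :
        Matrix (Z × Z) (Z × Z) ℂ) (z, z') (z, z') =
      if f u w = z ∧ f u w = z' then B.pre.map (Matrix.single v v 1) (w, k) (w, k) else 0 := by
    intro k z'
    rw [Finset.sum_eq_single u]
    · simp [Matrix.single_apply]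
    · intro u' _ hu
      simp [hu.symm, Matrix.single_apply]
    · simp
  simp only [this]
  by_cases h : f u w = z <;> simp [h]

theorem sum_idealFunctionality_single [DecidableEq Z] [DecidableEq U] [DecidableEq V] (f : U → V → Z)
    (u : U) (v : V) (z : Z) (hz : f u v ≠ z) :
    ∑ y, idealFunctionality f (Matrix.single (u, v) (u, v) 1) (z, y) (z, y) = 0 := by
  refine Finset.sum_eq_zero fun y _ => ?_
  simp only [idealFunctionality, LinearMap.sum_apply, Matrix.sum_apply, LinearMap.comp_apply]
  refine Finset.sum_eq_zero fun x _ => ?_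
  by_cases h : x = (u, v)
  · subst h; simp [hz]
  · have : (u, v) ≠ x := fun e => h e.symm
    simp [Matrix.single_apply, this]

end IdealWorld

/-! ### Alice's attack. -/

section Attack

/-- The Kraus operators are `|w⟩⟨z|` combined with the rows of a factor of `E w`; the register `Z`
is discarded. The effect measured on `e` is the transpose of `E w`, which matches the conjugated
entries of the matrix in `exists_alice_measuring_branch`. -/
theorem exists_measurement {V Z e : Type} [Fintype V] [DecidableEq V] [Fintype Z] [Fintype e]
    [DecidableEq e] (E : V → Matrix e e ℂ) (hE : ∀ w, (E w).PosSemidef) (h1 : ∑ w, E w = 1) :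
    ∃ Φ : Channel (Z × e) V, ∀ M w,
      Φ.map M w w = ∑ z, ∑ x, ∑ y, E w x y * M (z, x) (z, y) := by
  classical
  choose S hS using fun w => exists_eq_conjTranspose_mul_self (hE w)
  let K : V × Z × e → Matrix V (Z × e) ℂ := fun m =>
    Matrix.of fun i x => if i = m.1 ∧ x.1 = m.2.1 then star (S m.1 m.2.2 x.2) else 0
  have hK : ∀ M w, (∑ m, conjMap (K m)) M w w =
      ∑ z, ∑ x, ∑ y, E w x y * M (z, x) (z, y) := by
    intro M w
    simp only [LinearMap.sum_apply, Matrix.sum_apply, conjMap_entry, K, Matrix.of_apply,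
      Fintype.sum_prod_type]
    rw [Finset.sum_eq_single w]
    · refine Finset.sum_congr rfl fun z _ => ?_
      have : ∀ m, ∑ z', ∑ x, ∑ z'', ∑ y, (if w = w ∧ z' = z then star (S w m x) else 0) *
          M (z', x) (z'', y) * star (if w = w ∧ z'' = z then star (S w m y) else 0) =
          ∑ x, ∑ y, star (S w m x) * S w m y * M (z, x) (z, y) := by
        intro m
        rw [Finset.sum_eq_single z]
        · refine Finset.sum_congr rfl fun x _ => ?_
          rw [Finset.sum_eq_single z]
          · refine Finset.sum_congr rfl fun y _ => ?_
            simp only [and_self, if_true, star_star]; ring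
          · intro z'' _ hz; simp [hz]
          · simp
        · intro z'' _ hz; simp [hz]
        · simp
      rw [Finset.sum_congr rfl fun m _ => this m, Finset.sum_comm]
      refine Finset.sum_congr rfl fun x _ => ?_
      rw [Finset.sum_comm]
      refine Finset.sum_congr rfl fun y _ => ?_
      rw [← Finset.sum_mul, hS w]
      simp only [Matrix.mul_apply, Matrix.conjTranspose_apply]
    · intro w' _ hw; simp [hw.symm]
    · simp
  refine ⟨Channel.ofKraus (∑ m, conjMap (K m)) ⟨_, inferInstance, K, rfl⟩ fun M => ?_, hK⟩
  simp only [Matrix.trace, Matrix.diag_apply, hK]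
  have hsum : ∀ x y, ∑ w, E w x y = (1 : Matrix e e ℂ) x y := fun x y => by
    rw [← h1, Matrix.sum_apply]
  rw [Finset.sum_comm, Fintype.sum_prod_type]
  refine Finset.sum_congr rfl fun z _ => ?_
  rw [Finset.sum_comm]
  refine Finset.sum_congr rfl fun x _ => ?_
  rw [Finset.sum_comm]
  simp only [← Finset.sum_mul, hsum, Matrix.one_apply, ite_mul, one_mul, zero_mul,
    Finset.sum_ite_eq, Finset.mem_univ, if_true]

/-- Alice's strategy followed by a channel on her output. -/
noncomputable def AliceStrategy.postprocess {I : Interface} {U X X' : Type} [Fintype U] [Fintype X]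
    [Fintype X'] (A : AliceStrategy I U X) (Φ : Channel X X') : AliceStrategy I U X' where
  mem := A.mem
  init := A.init
  step := A.step
  final := Channel.ofKraus (Φ.map ∘ₗ A.final.map) (Φ.hasKraus.comp A.final.hasKraus)
    (Φ.isTP.comp A.final.isTP)

theorem runTo_postprocess {I : Interface} {U V X X' Y : Type} [Fintype U] [Fintype V] [Fintype X]
    [Fintype X'] [Fintype Y] (A : AliceStrategy I U X) (Φ : Channel X X') (B : BobStrategy I V Y)
    (i : ℕ) : runTo (A.postprocess Φ) B i = runTo A B i := by
  induction i with
  | zero => rfl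
  | succ i ih => simp only [runTo, ih]; rfl

theorem run_postprocess {I : Interface} {U V X X' Y : Type} [Fintype U] [Fintype V] [Fintype X]
    [Fintype X'] [Fintype Y] (A : AliceStrategy I U X) (Φ : Channel X X') (B : BobStrategy I V Y) :
    run (A.postprocess Φ) B = tensorId Y Φ.map ∘ₗ run A B := by
  simp only [run, runTo_postprocess]
  rfl

theorem sum_run_purify {I : Interface} {U V X Y : Type} [Fintype U] [Fintype V] [Fintype X]
    [Fintype Y] (A : AliceStrategy I U X) (B : BobStrategy I V Y) (M : Matrix (U × V) (U × V) ℂ)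
    (x : X) : ∑ y, run A B.purify M (x, y) (x, y) = ∑ y, run A B M (x, y) (x, y) := by
  rw [← idTensor_traceRight_run_purify A B, Fintype.sum_prod_type]
  rfl

theorem aliceOutcomeProb_eq_purify {I : Interface} {U V X Y : Type} [Fintype U] [DecidableEq U]
    [Fintype V] [DecidableEq V] [Fintype X] [Fintype Y] (A : AliceStrategy I U X)
    (B : BobStrategy I V Y) (u : U) (v : V) (x : X) :
    aliceOutcomeProb A B u v x = aliceOutcomeProb A B.purify u v x := by
  simp only [aliceOutcomeProb, ← Complex.re_sum, sum_run_purify]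

/-- If an execution is a sum of completely positive branches, Alice can find out the branch by a
measurement of the environment of her purified strategy, provided that Bob's strategy is pure. -/
theorem exists_alice_measuring_branch {I : Interface} {U V X Y T : Type} [Fintype U] [DecidableEq U]
    [Fintype V] [DecidableEq V] [Fintype X] [Fintype Y] [Fintype T] [DecidableEq T] [Nonempty T]
    (A : AliceStrategy I U X) (B : BobStrategy I V Y)
    (Φ : T → Matrix (U × V) (U × V) ℂ →ₗ[ℂ] Matrix (X × (Y × B.finalEnv)) (X × (Y × B.finalEnv)) ℂ)
    (hΦ : ∀ t, HasKraus (Φ t)) (hsum : run A B.purify = ∑ t, Φ t) :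
    ∃ A' : AliceStrategy I U T, ∀ u v t, aliceOutcomeProb A' B u v t =
      (∑ x, ∑ y, Φ t (Matrix.single (u, v) (u, v) 1) (x, y) (x, y)).re := by
  classical
  obtain ⟨W, hW⟩ := isConj_run_purify A B
  -- Rows are indexed by Alice's environment and columns by everything else, so `Mᴴ * M` traces the
  -- environment out and gives the Choi matrix of `run A B.purify`.
  let M : Matrix A.finalEnv ((U × V) × (X × (Y × B.finalEnv))) ℂ :=
    Matrix.of fun e i => star (W ((i.2.1, e), i.2.2) i.1)
  have hM : ∑ t, choi (Φ t) = Mᴴ * M := by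
    have h : ∑ t, choi (Φ t) = choi (run A B.purify) := by
      ext i j
      simp only [hsum, choi, Matrix.sum_apply, Matrix.of_apply, LinearMap.sum_apply]
    rw [h, ← tensorId_traceRight_run_purify A B.purify, hW]
    ext i j
    simp only [choi, Matrix.of_apply, LinearMap.comp_apply, tensorId_apply, traceRight_apply,
      conjMap_single, Matrix.mul_apply, Matrix.conjTranspose_apply, M, star_star]
  obtain ⟨E, hE, hE1, hEM⟩ := exists_povm_of_sum_eq M (fun t => (hΦ t).posSemidef_choi) hM
  obtain ⟨μ, hμ⟩ := exists_measurement (Z := X) E hE hE1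
  refine ⟨A.purify.postprocess μ, fun u v t => ?_⟩
  -- Alice's statistics are the same against `B` and against its purification, so the attack works
  -- on the unpurified Bob.
  rw [aliceOutcomeProb_eq_purify]
  simp only [aliceOutcomeProb, run_postprocess, hW, LinearMap.comp_apply, tensorId_apply]
  rw [← Complex.re_sum, Finset.sum_comm]
  congr 1
  refine Finset.sum_congr rfl fun y _ => ?_
  rw [hμ]
  refine Finset.sum_congr rfl fun x _ => ?_
  have h := congrFun (congrFun (hEM t) ((u, v), (x, y))) ((u, v), (x, y))
  simp only [choi, Matrix.of_apply] at h
  rw [← h]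
  simp only [Matrix.mul_apply, Finset.sum_mul, Matrix.conjTranspose_apply, M, Matrix.of_apply,
    star_star, conjMap_single]
  rw [Finset.sum_comm]
  refine Finset.sum_congr rfl fun e _ => Finset.sum_congr rfl fun e' _ => ?_
  ring

/-- An ideal adversary that simulates the purification of a correct Bob sends only inputs that are
equivalent to his own. -/
theorem IdealBob.inputProb_eq_zero {I : Interface} {U V Z : Type} [Fintype U] [DecidableEq U]
    [Fintype V] [DecidableEq V] [Fintype Z] [DecidableEq Z] {f : U → V → Z}
    {A : AliceStrategy I U Z} {B : BobStrategy I V Z} (S : IdealBob V Z (Z × B.finalEnv))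
    (hhonest : run A B = idealFunctionality f) (hpure : run A B.purify = idealRun f S)
    {u : U} {v w : V} (hne : f u v ≠ f u w) : S.inputProb v w = 0 := by
  -- The left side is the probability that Alice outputs the wrong value `f u w` on inputs `u`, `v`;
  -- it can be computed in the honest execution because purifying Bob leaves her output unchanged.
  have h : ∑ w', (if f u w' = f u w then S.inputProb v w' else 0) = 0 := by
    refine Eq.trans ?_ (sum_idealFunctionality_single f u v _ hne)
    rw [← hhonest, ← sum_run_purify, hpure, idealRun_eq_sum]
    simp only [LinearMap.sum_apply, Matrix.sum_apply]
    rw [Finset.sum_comm]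
    exact Finset.sum_congr rfl fun w' _ => (sum_idealRunBranch_single f S u v w' _).symm
  rw [Finset.sum_eq_zero_iff_of_nonneg fun w' _ => by
    split_ifs
    exacts [S.inputProb_nonneg v w', le_rfl]] at h
  simpa using h w (Finset.mem_univ w)

end Attack

end QTwoParty

open QTwoParty in
theorem theorem1 {U V Z : Type} [Fintype U] [DecidableEq U] [Nonempty U]
    [Fintype V] [DecidableEq V] [Nonempty V] [Fintype Z] [DecidableEq Z]
    (f : U → V → Z) (π : Protocol U V Z)
    (hcorrect : IsCorrect π f 0) (hsecure : IsSecureAgainstBob π f 0) :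
    ∃ A' : AliceStrategy π.interface U V, ∀ (u₀ : U) (v : V),
      ∑ w with (∀ u, f u v = f u w), aliceOutcomeProb A' π.bob u₀ v w = 1 := by
  classical
  have hu := uniform_mem_stdSimplex (U × V)
  have hideal : HasKraus (idealFunctionality f) := by
    rw [idealFunctionality_eq_sum]
    exact HasKraus.sum fun w => hasKraus_idealBranch f w
  have hhonest : run π.alice π.bob = idealFunctionality f :=
    map_eq_of_purifiedDistance_nonpos (hasKraus_run _ _) hideal (isTP_run _ _)
      (isTP_idealFunctionality f) (hcorrect _ hu)
  -- The only attack of Bob that is needed: honest behaviour with the environment kept.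
  obtain ⟨B, hB⟩ := hsecure _ hu _ π.bob.purify
  have hpure : run π.alice π.bob.purify = idealRun f B :=
    map_eq_of_purifiedDistance_nonpos (hasKraus_run _ _) (hasKraus_idealRun f B) (isTP_run _ _)
      (isTP_idealRun f B) hB
  obtain ⟨A', hA'⟩ := exists_alice_measuring_branch π.alice π.bob (idealRunBranch f B)
    (hasKraus_idealRunBranch f B) (hpure.trans (idealRun_eq_sum f B))
  refine ⟨A', fun u₀ v => ?_⟩
  -- Summing over the value `z` of Alice's regular output leaves only the simulator's law of `w`,
  -- free of `u₀`.
  have hprob : ∀ w, aliceOutcomeProb A' π.bob u₀ v w = (B.inputProb v w).re := by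
    intro w
    rw [hA']
    simp only [sum_idealRunBranch_single, Finset.sum_ite_eq, Finset.mem_univ, if_true]
  simp only [hprob]
  -- The condition on `w` can be dropped since inequivalent inputs have probability zero.
  rw [← Complex.re_sum, Finset.sum_filter_of_ne, B.sum_inputProb, Complex.one_re]
  intro w _ hw u
  by_contra hne
  exact hw (B.inputProb_eq_zero hhonest hpure hne)
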